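/- Let $\|\cdot\|$ be a polyhedral norm on $\mathbb{R}^d$ (a norm whose unit ball is a finite intersection of closed half-spaces), let $P=\{x:\|x\|\le \tfrac12\}$, let $V$ be its set of vertices and $n=|V|$. For $a\in S^{d-1}$ and $t\ge 0$ put $\operatorname{slab}(a,t)=\{x\in P: |\langle a,x\rangle|\le t/2\}$. Let $R$ be a connected component of $S^{d-1}\setminus\bigcup_{v\ne w\in V}(v-w)^\perp$. For $a\in R$ let $v_1,\dots,v_{n/2}$ be the vertices of $P$ with $\langle a,v\rangle>0$, ordered so that $\langle a,v_1\rangle<\dots<\langle a,v_{n/2}\rangle$. For $0\le j<n/2$, the set of all $(a,t)$ such that $a\in R$ and $\langle a,v_j\rangle<t/2<\langle a,v_{j+1}\rangle$ (with $\langle a,v_0\rangle$ replaced by $0$) is called a maximal slicing chamber. A rational formula for a function $f$ on a set $C\subset S^{d-1}\times\mathbb R$ is a pair of real polynomials $p,q$ in $a_1,\dots,a_d,t$ such that $q$ has no zero in $C$ and $f=p/q$ on $C$. For every maximal slicing chamber $C$ the following hold. 1. For all $(a,t),(a',t')\in C$, the polytopes $\operatorname{slab}(a,t)$ and $\operatorname{slab}(a',t')$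 have the same combinatorial type, i.e. isomorphic face lattices. 2. The vertices have the same rational parametrization on all of $C$: there are finitely many maps $x_1,\dots,x_k$, whose coordinates have rational formulas on $C$, such that for every $(a,t)\in C$ the points $x_1(a,t),\dots,x_k(a,t)$ are pairwise distinct and are exactly the vertices of $\operatorname{slab}(a,t)$. Each $x_i$ is either a constant vertex of $P$ or given by $$\frac{\pm t/2}{\langle a,w-v\rangle}(w-v)+\frac{\langle a,w\rangle v-\langle a,v\rangle w}{\langle a,w-v\rangle}$$ for an edge of $P$ with end points $v\neq w$ and a fixed sign, that is, by the intersection of that edge with the hyperplane $\{\langle a,x\rangle=\pm t/2\}$. Whether $\operatorname{conv}\{x_i(a,t): i\in\sigma\}$ is a face of $\operatorname{slab}(a,t)$ depends, for each $\sigma\subseteq\{1,\dots,k\}$, only on $\sigma$ and not on $(a,t)\in C$. 3. The function $(a,t)\mapsto\operatorname{vol}(\operatorname{slab}(a,t))$ has a rational formula on $C$. 4. This volume function is continuous on the closure $\overline C$. For every rational formula $p/q$ for it on $C$ and every $y\in\overline C$, the limit of $p/q$ at $y$ along $C$ exists and equals the volume of the slab with parameter $y$; in particular that volume equals $p(y)/q(y)$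 whenever $q(y)\neq0$. Moreover, rational formulas for the volume on two maximal slicing chambers have the same limits (each taken along its own chamber) at every point common to both closures. Finally, there are only finitely many maximal slicing chambers, and for every $(a,t)\in S^{d-1}\times[0,\infty)$ either $(a,t)$ lies in the closure of some maximal slicing chamber or $\operatorname{slab}(a,t)=P$; so the formulas on the chambers, together with $\operatorname{vol}(P)$, give the volumes of all slabs. -/

import Mathlib

open Set Filter Topology MeasureTheory
open scoped RealInnerProductSpace

noncomputable section

namespace SlabChambers

/-- A (closed, convex) polyhedron: a finite intersection of closed half-spaces. -/
def IsPolyhedron {d : ℕ} (Q : Set (EuclideanSpace ℝ (Fin d))) : Prop :=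
  ∃ S : Set (EuclideanSpace ℝ (Fin d) × ℝ), S.Finite ∧ Q = {x | ∀ h ∈ S, ⟪h.1, x⟫ ≤ h.2}

/-- A polyhedral norm on `ℝ^d`: a norm whose unit ball is a polyhedron. -/
structure IsPolyhedralNorm {d : ℕ} (N : Seminorm ℝ (EuclideanSpace ℝ (Fin d))) : Prop where
  definite : ∀ x, N x = 0 → x = 0
  polyhedral : IsPolyhedron {x | N x ≤ 1}

/-- The scaled unit ball `{x : ‖x‖ ≤ 1/2}`. -/
def normBall {d : ℕ} (N : Seminorm ℝ (EuclideanSpace ℝ (Fin d))) :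
    Set (EuclideanSpace ℝ (Fin d)) :=
  {x | N x ≤ 1 / 2}

/-- The slab `{x : ‖x‖ ≤ 1/2, |⟨a, x⟩| ≤ t/2}`. -/
def slab {d : ℕ} (N : Seminorm ℝ (EuclideanSpace ℝ (Fin d)))
    (a : EuclideanSpace ℝ (Fin d)) (t : ℝ) : Set (EuclideanSpace ℝ (Fin d)) :=
  {x | x ∈ normBall N ∧ |⟪a, x⟫| ≤ t / 2}

/-- The volume of the slab, as a function of the parameters `(a, t)`. -/
def slabVolume {d : ℕ} (N : Seminorm ℝ (EuclideanSpace ℝ (Fin d)))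
    (y : EuclideanSpace ℝ (Fin d) × ℝ) : ℝ :=
  (volume : Measure (EuclideanSpace ℝ (Fin d))).real (slab N y.1 y.2)

/-! ### Sweep arrangement, regions, chambers -/

/-- The set of vertices of `P`. -/
def vertices {d : ℕ} (P : Set (EuclideanSpace ℝ (Fin d))) : Set (EuclideanSpace ℝ (Fin d)) :=
  P.extremePoints ℝ

/-- The union of the hyperplanes `(v - w)^⊥`, over distinct vertices `v`, `w` of `P`. -/
def sweepArrangement {d : ℕ} (P : Set (EuclideanSpace ℝ (Fin d))) :
    Set (EuclideanSpace ℝ (Fin d)) :=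
  {a | ∃ v ∈ vertices P, ∃ w ∈ vertices P, v ≠ w ∧ ⟪a, v - w⟫ = 0}

/-- The regions of the sweep arrangement on the sphere: the connected components of the
complement of the arrangement in the unit sphere. -/
def IsSweepRegion {d : ℕ} (P R : Set (EuclideanSpace ℝ (Fin d))) : Prop :=
  ∃ a ∈ Metric.sphere (0 : EuclideanSpace ℝ (Fin d)) 1 \ sweepArrangement P,
    R = connectedComponentIn (Metric.sphere 0 1 \ sweepArrangement P) a

/-- The vertices of `P` at which `⟨a, ·⟩` is positive. -/
def positiveVertices {d : ℕ} (P : Set (EuclideanSpace ℝ (Fin d)))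
    (a : EuclideanSpace ℝ (Fin d)) : Set (EuclideanSpace ℝ (Fin d)) :=
  {v | v ∈ vertices P ∧ 0 < ⟪a, v⟫}

/-- `v 1, …, v m` lists the positive vertices with respect to `a` by increasing value of
`⟨a, ·⟩` (values of `v` outside `{1, …, m}` are irrelevant). -/
def IsInducedOrdering {d : ℕ} (P : Set (EuclideanSpace ℝ (Fin d)))
    (a : EuclideanSpace ℝ (Fin d)) (v : ℕ → EuclideanSpace ℝ (Fin d)) : Prop :=
  v '' Icc 1 (positiveVertices P a).ncard = positiveVertices P a ∧
    StrictMonoOn (fun k => ⟪a, v k⟫) (Icc 1 (positiveVertices P a).ncard)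

/-- The open interval of all `t` with `⟨a, v_j⟩ < t/2 < ⟨a, v_{j+1}⟩`, where `v_1, …, v_m` are
the positive vertices in the ordering induced by `a`; for `j = 0` the lower bound is `0`. -/
def sweepInterval {d : ℕ} (P : Set (EuclideanSpace ℝ (Fin d))) (j : ℕ)
    (a : EuclideanSpace ℝ (Fin d)) : Set ℝ :=
  {t | j < (positiveVertices P a).ncard ∧ ∃ v : ℕ → EuclideanSpace ℝ (Fin d),
    IsInducedOrdering P a v ∧ (if j = 0 then 0 else ⟪a, v j⟫) < t / 2 ∧ t / 2 < ⟪a, v (j + 1)⟫}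

/-- The chamber of the region `R` with index `j`. -/
def chamber {d : ℕ} (P R : Set (EuclideanSpace ℝ (Fin d))) (j : ℕ) :
    Set (EuclideanSpace ℝ (Fin d) × ℝ) :=
  {y | y.1 ∈ R ∧ y.2 ∈ sweepInterval P j y.1}

/-- Maximal (open) slicing chambers of a centrally symmetric polytope `P` with `n` vertices:
one for each region of the sweep arrangement and each index `0 ≤ j < n / 2`. -/
def IsMaximalChamber {d : ℕ} (P : Set (EuclideanSpace ℝ (Fin d)))
    (C : Set (EuclideanSpace ℝ (Fin d) × ℝ)) : Prop :=
  ∃ R, IsSweepRegion P R ∧ ∃ j < (vertices P).ncard / 2, C = chamber P R j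

/-! ### Combinatorial type and parametrization of vertices -/

/-- Same combinatorial type: the face lattices, i.e. the sets of (exposed) faces ordered by
inclusion, including the empty face and the whole polytope, are isomorphic. -/
def SameCombinatorialType {d : ℕ} (Q Q' : Set (EuclideanSpace ℝ (Fin d))) : Prop :=
  Nonempty ({F : Set (EuclideanSpace ℝ (Fin d)) // IsExposed ℝ Q F} ≃o
    {F : Set (EuclideanSpace ℝ (Fin d)) // IsExposed ℝ Q' F})

/-- `v` and `w` are the two end points of an edge of `P`. -/
def IsEdge {d : ℕ} (P : Set (EuclideanSpace ℝ (Fin d))) (v w : EuclideanSpace ℝ (Fin d)) : Prop :=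
  v ∈ vertices P ∧ w ∈ vertices P ∧ v ≠ w ∧ IsExposed ℝ P (segment ℝ v w)

/-- The intersection point of the line through `v`, `w` with the hyperplane
`{x : ⟨a, x⟩ = t/2}`. -/
def edgePoint {d : ℕ} (v w a : EuclideanSpace ℝ (Fin d)) (t : ℝ) : EuclideanSpace ℝ (Fin d) :=
  ((t / 2) / ⟪a, w - v⟫) • (w - v) + (1 / ⟪a, w - v⟫) • (⟪a, w⟫ • v - ⟪a, v⟫ • w)

/-- The two kinds of formulas for the vertices of a slab: a constant vertex of `P`, or the
intersection of an edge of `P` with `{⟨a, x⟩ = t/2}` or `{⟨a, x⟩ = -t/2}`. -/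
def IsVertexFormula {d : ℕ} (P : Set (EuclideanSpace ℝ (Fin d)))
    (f : EuclideanSpace ℝ (Fin d) × ℝ → EuclideanSpace ℝ (Fin d)) : Prop :=
  (∃ v ∈ vertices P, ∀ y, f y = v) ∨
  (∃ v w, IsEdge P v w ∧
    ((∀ y, f y = edgePoint v w y.1 y.2) ∨ (∀ y, f y = edgePoint v w y.1 (-y.2))))

/-! ### Rational functions of `(a, t)` -/

/-- The value at `(a, t)` of a polynomial in the variables `a_1, …, a_d` (indices `some i`) and
`t` (index `none`). -/
def polyVal {d : ℕ} (p : MvPolynomial (Option (Fin d)) ℝ) (y : EuclideanSpace ℝ (Fin d) × ℝ) :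
    ℝ :=
  MvPolynomial.eval (fun o : Option (Fin d) => o.elim y.2 fun i => y.1 i) p

/-- On `C` the function `f` is given by the rational function `p / q`, whose denominator has no
zero in `C`. -/
def IsRationalFormula {d : ℕ} (C : Set (EuclideanSpace ℝ (Fin d) × ℝ))
    (f : EuclideanSpace ℝ (Fin d) × ℝ → ℝ) (p q : MvPolynomial (Option (Fin d)) ℝ) : Prop :=
  ∀ y ∈ C, polyVal q y ≠ 0 ∧ f y = polyVal p y / polyVal q y

end SlabChambers

end

/-!
On a chamber the ordering of the vertices of the ball `P` by `⟨a, ·⟩` is constant, and so is the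
set of vertices above each of the levels `± t / 2`; no vertex lies on these levels
(`IsMaximalChamber.isGenericFor`, `IsMaximalChamber.sameSides`). Everything else depends on the
chamber only through these facts.

*Vertices and faces.* A vertex of the slab is a vertex of `P` strictly inside the slab or the
intersection of an edge of `P` with one of the two hyperplanes (`range_labelPoint`), so the vertices
are labelled by data that are constant on the chamber. Write `P` and the slab as systems of linear
inequalities. A nonempty set of vertices spans a face if and only if it consists of all vertices at
which certain inequalities are equalities (`isExposed_convexHull_iff`). The incidences between vertices
and inequalities are constant on the chamber (`labelPoint_incidence`), hence so is the combinatorial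
type.

*Volume.* The slab is `P` without two congruent caps (`slabVolume_eq_sub`). The polytope is
decomposed into simplices on its own vertices by a regular triangulation, i.e. by lifting the
vertices to generic heights and projecting the lower faces of their convex hull
(`exists_triangulation`). The part of a simplex with vertices `v i` in the half-space
`{x | s < ⟨a, x⟩}` has as its volume a constant multiple of
`∑ i, (⟨a, v i⟩ - s)₊ ^ d / ∏ k ≠ i, ⟨a, v i - v k⟩`, as an induction on the dimension shows
(`volume_cutSimplex`, `volume_convexHull_inter_halfSpace`). On a chamber the denominators do not
vanish and the signs of the `⟨a, v i⟩ - t / 2` are constant, so that this is a rational function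
(`hasRationalFormula_slabVolume`). No triangulation of the slab itself is needed.

*Closures.* The volume of the slab is continuous in `(a, t)` wherever `a ≠ 0`, because hyperplanes
are null sets (`continuousAt_slabVolume`). This gives the limits of the rational formulas, and their
agreement along common boundaries.

*Counting and covering.* Two directions that order the vertices in the same way can be joined
inside the region by the normalized segment, so there are finitely many regions
(`finite_sweepRegions`). If some vertex lies above the level `t / 2`, then moving `(a, t)` in a
generic direction leads into chambers, and finitely many of them, whence `(a, t)` belongs to the
closure of one (`exists_mem_closure_maximalChamber`). Otherwise the slab contains all vertices.
-/

namespace SlabChambers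

/-! ### Faces of polyhedra -/

section Polyhedra

variable {E ι κ : Type*} [NormedAddCommGroup E] [InnerProductSpace ℝ E]

/-- The polyhedron `{x : ⟨h i, x⟩ ≤ b i for all i}`. Indexing the inequalities by a type allows
different polyhedra to be compared constraint by constraint. -/
def poly (h : ι → E) (b : ι → ℝ) : Set E := {x | ∀ i, ⟪h i, x⟫ ≤ b i}

/-- The points of a polyhedron at which all constraints in `I` are equalities. -/
def tightFace (h : ι → E) (b : ι → ℝ) (I : Set ι) : Set E :=
  {x | x ∈ poly h b ∧ ∀ i ∈ I, ⟪h i, x⟫ = b i}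

variable {h : ι → E} {b : ι → ℝ}

lemma convex_poly : Convex ℝ (poly h b) := by
  have : poly h b = ⋂ i, {x | (innerSL ℝ (h i)) x ≤ b i} := by
    ext x; simp [poly]
  rw [this]
  exact convex_iInter fun i => convex_halfSpace_le (innerSL ℝ (h i)).isLinear _

/-- From a point of a polyhedron one can move a little in every direction that does not increase
the tight constraints. -/
lemma eventually_add_smul_mem_poly [Finite ι] {x u : E} (hx : x ∈ poly h b)
    (hu : ∀ i, ⟪h i, x⟫ = b i → ⟪h i, u⟫ ≤ 0) : ∀ᶠ ε in 𝓝[>] (0 : ℝ), x + ε • u ∈ poly h b := by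
  simp only [poly, mem_ofPred_eq, eventually_all]
  intro i
  rcases (hx i).lt_or_eq with hlt | heq
  · have hc : Continuous fun ε : ℝ => ⟪h i, x + ε • u⟫ := by fun_prop
    have : Tendsto (fun ε : ℝ => ⟪h i, x + ε • u⟫) (𝓝[>] 0) (𝓝 ⟪h i, x⟫) := by
      simpa using (hc.tendsto 0).mono_left nhdsWithin_le_nhds
    exact (this.eventually_lt_const hlt).mono fun _ => le_of_lt
  · filter_upwards [self_mem_nhdsWithin] with ε hε
    rw [inner_add_right, inner_smul_right, heq]
    nlinarith [hu i heq, mem_Ioi.1 hε]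

lemma exists_add_smul_mem_poly [Finite ι] {x u : E} (hx : x ∈ poly h b)
    (hu : ∀ i, ⟪h i, x⟫ = b i → ⟪h i, u⟫ ≤ 0) : ∃ ε : ℝ, 0 < ε ∧ x + ε • u ∈ poly h b :=
  ((eventually_add_smul_mem_poly hx hu).and self_mem_nhdsWithin).exists.imp fun _ hε =>
    ⟨hε.2, hε.1⟩

/-- If `ε > 0`, then `x` lies strictly between `y` and `x + ε (x - y)`. -/
lemma mem_openSegment_add_smul_sub {x y : E} {ε : ℝ} (hε : 0 < ε) :
    x ∈ openSegment ℝ y (x + ε • (x - y)) := by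
  refine ⟨ε / (1 + ε), 1 / (1 + ε), by positivity, by positivity, by field_simp; ring, ?_⟩
  have h1 : (1 + ε) ≠ 0 := by positivity
  have : (ε / (1 + ε)) • y + (1 / (1 + ε)) • (x + ε • (x - y)) =
      (1 / (1 + ε) + ε / (1 + ε)) • x := by
    module
  rw [this, ← add_div, div_self h1, one_smul]

/-- An extreme point of a polyhedron is determined by its tight constraints. -/
lemma extremePoint_poly_eq [Finite ι] {x y : E} (hx : x ∈ (poly h b).extremePoints ℝ)
    (hy : y ∈ poly h b) (hxy : ∀ i, ⟪h i, x⟫ = b i → ⟪h i, y⟫ = b i) : y = x := by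
  obtain ⟨ε, hε, hm⟩ := exists_add_smul_mem_poly (u := x - y) hx.1 fun i hi => by
    rw [inner_sub_right, hi, hxy i hi, sub_self]
  exact hx.2 hy hm (mem_openSegment_add_smul_sub hε)

lemma finite_extremePoints_poly [Finite ι] : ((poly h b).extremePoints ℝ).Finite := by
  refine Set.Finite.of_finite_image (f := fun x => {i | ⟪h i, x⟫ = b i}) (Set.toFinite _) ?_
  intro x hx y hy hxy
  refine extremePoint_poly_eq hy hx.1 fun i hi => ?_
  have : i ∈ {i | ⟪h i, x⟫ = b i} := by
    rw [show {i | ⟪h i, x⟫ = b i} = {i | ⟪h i, y⟫ = b i} from hxy]; exact hi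
  exact this

/-- A convex subset of a polyhedron has a point at which only those constraints are tight which
are tight on the whole subset. -/
lemma exists_minimal_tight [Finite ι] {F : Set E} (hF : Convex ℝ F) (hne : F.Nonempty)
    (hsub : F ⊆ poly h b) :
    ∃ x ∈ F, ∀ i, ⟪h i, x⟫ = b i → ∀ y ∈ F, ⟪h i, y⟫ = b i := by
  let f : E → ℕ := fun x => {i | ⟪h i, x⟫ = b i}.ncard
  refine ⟨Function.argminOn f F hne, Function.argminOn_mem .., fun i hi y hy => ?_⟩
  set x := Function.argminOn f F hne
  have hx : x ∈ F := Function.argminOn_mem ..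
  by_contra hcon
  -- The midpoint of `x` and `y` has fewer tight constraints than `x`.
  have hmem : midpoint ℝ x y ∈ F := hF.midpoint_mem hx hy
  have key : ∀ j, ⟪h j, midpoint ℝ x y⟫ = b j → ⟪h j, x⟫ = b j ∧ ⟪h j, y⟫ = b j := by
    intro j hj
    rw [midpoint_eq_smul_add, inner_smul_right, inner_add_right] at hj
    have h1 := hsub hx j
    have h2 := hsub hy j
    norm_num at hj
    constructor <;> linarith
  have hlt : f (midpoint ℝ x y) < f x := by
    refine Set.ncard_lt_ncard ⟨fun j hj => (key j hj).1, fun hss => ?_⟩ (Set.toFinite _)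
    exact hcon (key i (hss hi)).2
  exact absurd (Function.argminOn_le f F hmem) (not_le.2 hlt)

lemma isExposed_tightFace [Finite ι] (I : Set ι) : IsExposed ℝ (poly h b) (tightFace h b I) := by
  classical
  have := Fintype.ofFinite ι
  rintro ⟨z, hz⟩
  refine ⟨∑ i with i ∈ I, innerSL ℝ (h i), ?_⟩
  have hl : ∀ x, (∑ i with i ∈ I, innerSL ℝ (h i)) x = ∑ i with i ∈ I, ⟪h i, x⟫ := by
    intro x; simp [sum_apply]
  have hsum : ∀ x ∈ tightFace h b I, ∑ i with i ∈ I, ⟪h i, x⟫ = ∑ i with i ∈ I, b i :=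
    fun x hx => Finset.sum_congr rfl fun i hi => hx.2 i (Finset.mem_filter.1 hi).2
  ext x
  simp only [hl, mem_ofPred_eq]
  constructor
  · intro hx
    refine ⟨hx.1, fun y hy => ?_⟩
    rw [hsum x hx]
    exact Finset.sum_le_sum fun i _ => hy i
  · rintro ⟨hx, hmax⟩
    refine ⟨hx, fun i hi => ?_⟩
    have h1 := hmax z hz.1
    rw [hsum z hz] at h1
    have h2 := (Finset.sum_eq_sum_iff_of_le fun i _ => hx i).1
      (le_antisymm (Finset.sum_le_sum fun i (_ : i ∈ Finset.univ.filter (· ∈ I)) => hx i) h1)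
    exact h2 i (by simpa using hi)

/-- Every nonempty exposed face of a polyhedron is cut out by turning some of the inequalities
into equalities. -/
lemma exists_eq_tightFace [Finite ι] {F : Set E} (hF : IsExposed ℝ (poly h b) F)
    (hne : F.Nonempty) : ∃ I, F = tightFace h b I := by
  obtain ⟨x, hx, hmin⟩ := exists_minimal_tight (hF.convex convex_poly) hne hF.subset
  obtain ⟨l, hl⟩ := hF hne
  refine ⟨{i | ⟪h i, x⟫ = b i}, Subset.antisymm
    (fun y hy => ⟨hF.subset hy, fun i hi => hmin i hi y hy⟩) fun y hy => ?_⟩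
  obtain ⟨ε, hε, hm⟩ := exists_add_smul_mem_poly (u := x - y) (hF.subset hx) fun i hi => by
    rw [inner_sub_right, hi, hy.2 i hi, sub_self]
  rw [hl] at hx ⊢
  refine ⟨hy.1, fun z hz => (hx.2 z hz).trans ?_⟩
  have := hx.2 _ hm
  simp only [map_add, map_smul, map_sub, smul_eq_mul] at this
  nlinarith

lemma convexHull_extremePoints_eq {Q : Set E} (hc : IsCompact Q) (hconv : Convex ℝ Q)
    (hfin : (Q.extremePoints ℝ).Finite) : convexHull ℝ (Q.extremePoints ℝ) = Q := by
  have := closure_convexHull_extremePoints hc hconv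
  rwa [(hfin.isCompact_convexHull (𝕜 := ℝ)).isClosed.closure_eq] at this

/-- A face of a polytope is the convex hull of the vertices it contains. -/
lemma exposed_eq_convexHull {Q F : Set E} (hc : IsCompact Q) (hconv : Convex ℝ Q)
    (hfin : (Q.extremePoints ℝ).Finite) (hF : IsExposed ℝ Q F) :
    F = convexHull ℝ (F ∩ Q.extremePoints ℝ) := by
  have h1 := hF.isExtreme.extremePoints_eq
  rw [← h1]
  exact (convexHull_extremePoints_eq (hF.isCompact hc) (hF.convex hconv)
    (hfin.subset (h1 ▸ inter_subset_right))).symm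

/-- A vertex in the convex hull of a set of vertices belongs to the set. -/
lemma mem_of_mem_convexHull_image {Q : Set E} (hconv : Convex ℝ Q) {x : κ → E}
    (hinj : Function.Injective x) (hr : range x = Q.extremePoints ℝ) {σ : Set κ} {i : κ}
    (hi : x i ∈ convexHull ℝ (x '' σ)) : i ∈ σ := by
  have hsub : convexHull ℝ (x '' σ) ⊆ Q := by
    refine convexHull_min ?_ hconv
    rintro _ ⟨j, -, rfl⟩
    exact extremePoints_subset (𝕜 := ℝ) (hr ▸ mem_range_self j)
  have h1 : x i ∈ (convexHull ℝ (x '' σ)).extremePoints ℝ :=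
    inter_extremePoints_subset_extremePoints_of_subset hsub ⟨hi, hr ▸ mem_range_self i⟩
  obtain ⟨j, hj, hji⟩ := extremePoints_convexHull_subset h1
  exact hinj hji ▸ hj

/-- Which sets of vertices span a face can be read off from the incidences between vertices and
constraints. -/
lemma isExposed_convexHull_iff [Finite ι] (hc : IsCompact (poly h b)) {x : κ → E}
    (hinj : Function.Injective x) (hr : range x = (poly h b).extremePoints ℝ) (σ : Set κ) :
    IsExposed ℝ (poly h b) (convexHull ℝ (x '' σ)) ↔
      σ = ∅ ∨ ∃ I : Set ι, σ = {j | ∀ i ∈ I, ⟪h i, x j⟫ = b i} := by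
  have hmem : ∀ j, x j ∈ poly h b := fun j =>
    extremePoints_subset (𝕜 := ℝ) (hr ▸ mem_range_self j)
  constructor
  · intro hF
    rcases σ.eq_empty_or_nonempty with h0 | hne
    · exact .inl h0
    right
    obtain ⟨I, hI⟩ := exists_eq_tightFace hF (hne.image x).convexHull
    refine ⟨I, ext fun j => ⟨fun hj => ?_, fun hj => ?_⟩⟩
    · have : x j ∈ convexHull ℝ (x '' σ) := subset_convexHull ℝ _ (mem_image_of_mem x hj)
      rw [hI] at this
      exact this.2
    · refine mem_of_mem_convexHull_image convex_poly hinj hr (σ := σ) ?_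
      rw [hI]
      exact ⟨hmem j, hj⟩
  · rintro (rfl | ⟨I, rfl⟩)
    · simpa using isExposed_empty
    · have hF := isExposed_tightFace (h := h) (b := b) I
      have h1 := exposed_eq_convexHull hc convex_poly finite_extremePoints_poly hF
      convert hF
      rw [h1, ← hr]
      congr 1
      ext y
      constructor
      · rintro ⟨j, hj, rfl⟩
        exact ⟨⟨hmem j, hj⟩, mem_range_self j⟩
      · rintro ⟨hy, j, rfl⟩
        exact ⟨j, hy.2, rfl⟩

lemma exposed_eq_convexHull_image {Q F : Set E} (hc : IsCompact Q) (hconv : Convex ℝ Q)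
    [Finite κ] {x : κ → E} (hr : range x = Q.extremePoints ℝ) (hF : IsExposed ℝ Q F) :
    F = convexHull ℝ (x '' {j | x j ∈ F}) := by
  conv_lhs => rw [exposed_eq_convexHull hc hconv (hr ▸ finite_range x) hF, ← hr]
  congr 1
  ext y
  constructor
  · rintro ⟨hy, j, rfl⟩
    exact ⟨j, hy, rfl⟩
  · rintro ⟨j, hj, rfl⟩
    exact ⟨hj, mem_range_self j⟩

/-- Two polytopes whose vertices are labelled by the same set so that the same sets of labels
belong to faces have isomorphic face lattices. -/
lemma nonempty_orderIso_exposed [Finite κ] {Q Q' : Set E} (hc : IsCompact Q) (hconv : Convex ℝ Q)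
    (hc' : IsCompact Q') (hconv' : Convex ℝ Q') {x x' : κ → E} (hinj : Function.Injective x)
    (hinj' : Function.Injective x') (hr : range x = Q.extremePoints ℝ)
    (hr' : range x' = Q'.extremePoints ℝ)
    (hface : ∀ σ : Set κ, IsExposed ℝ Q (convexHull ℝ (x '' σ)) ↔
      IsExposed ℝ Q' (convexHull ℝ (x' '' σ))) :
    Nonempty ({F : Set E // IsExposed ℝ Q F} ≃o {F : Set E // IsExposed ℝ Q' F}) := by
  have hlabel : ∀ {Q : Set E} {x : κ → E}, Convex ℝ Q → Function.Injective x →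
      range x = Q.extremePoints ℝ → ∀ σ : Set κ, {j | x j ∈ convexHull ℝ (x '' σ)} = σ :=
    fun hconv hinj hr σ => ext fun j => ⟨mem_of_mem_convexHull_image hconv hinj hr,
      fun hj => subset_convexHull ℝ _ (mem_image_of_mem _ hj)⟩
  have hx := fun F => exposed_eq_convexHull_image (F := F) hc hconv hr
  have hx' := fun F => exposed_eq_convexHull_image (F := F) hc' hconv' hr'
  refine ⟨⟨⟨fun F => ⟨convexHull ℝ (x' '' {j | x j ∈ F.1}), (hface _).1 (hx F.1 F.2 ▸ F.2)⟩,
    fun F => ⟨convexHull ℝ (x '' {j | x' j ∈ F.1}), (hface _).2 (hx' F.1 F.2 ▸ F.2)⟩,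
    fun F => ?_, fun F => ?_⟩, fun {F G} => ?_⟩⟩
  · ext1
    simp only [hlabel hconv' hinj' hr']
    exact (hx F.1 F.2).symm
  · ext1
    simp only [hlabel hconv hinj hr]
    exact (hx' F.1 F.2).symm
  · simp only [Equiv.coe_fn_mk, ← Subtype.coe_le_coe]
    constructor
    · intro hFG
      rw [hx F.1 F.2, hx G.1 G.2]
      refine convexHull_mono (image_mono fun j hj => ?_)
      have : j ∈ {j | x' j ∈ convexHull ℝ (x' '' {j | x j ∈ G.1})} :=
        hFG (subset_convexHull ℝ _ (mem_image_of_mem x' hj))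
      rwa [hlabel hconv' hinj' hr'] at this
    · intro hFG
      exact convexHull_mono (image_mono fun j hj => hFG hj)

end Polyhedra

/-! ### Vertices of slabs -/

section EdgePoints

variable {d : ℕ} {v w a x : EuclideanSpace ℝ (Fin d)} {t : ℝ}

lemma edgePoint_eq (hvw : ⟪a, v⟫ ≠ ⟪a, w⟫) :
    edgePoint v w a t = v + ((t / 2 - ⟪a, v⟫) / (⟪a, w⟫ - ⟪a, v⟫)) • (w - v) := by
  have h0 : ⟪a, w⟫ - ⟪a, v⟫ ≠ 0 := sub_ne_zero.2 hvw.symm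
  rw [edgePoint, inner_sub_right]
  generalize hD : ⟪a, w⟫ - ⟪a, v⟫ = D at h0
  obtain hw : ⟪a, w⟫ = D + ⟪a, v⟫ := by linarith
  have h1 : (1 / D) • ((D + ⟪a, v⟫) • v - ⟪a, v⟫ • w) =
      (1 / D * D) • v - (⟪a, v⟫ / D) • (w - v) := by module
  rw [hw, h1, one_div_mul_cancel h0]
  module

lemma inner_edgePoint (hvw : ⟪a, v⟫ ≠ ⟪a, w⟫) : ⟪a, edgePoint v w a t⟫ = t / 2 := by
  have h0 : ⟪a, w⟫ - ⟪a, v⟫ ≠ 0 := sub_ne_zero.2 hvw.symm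
  rw [edgePoint_eq hvw, inner_add_right, inner_smul_right, inner_sub_right]
  field_simp
  ring

lemma edgePoint_mem_openSegment (hv : ⟪a, v⟫ < t / 2) (hw : t / 2 < ⟪a, w⟫) :
    edgePoint v w a t ∈ openSegment ℝ v w := by
  have h0 : 0 < ⟪a, w⟫ - ⟪a, v⟫ := by linarith
  rw [edgePoint_eq (by linarith), openSegment_eq_image']
  refine ⟨_, ⟨div_pos (by linarith) h0, (div_lt_one h0).2 (by linarith)⟩, rfl⟩

lemma eq_edgePoint_of_mem_segment (hvw : ⟪a, v⟫ ≠ ⟪a, w⟫) (hx : x ∈ segment ℝ v w)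
    (hax : ⟪a, x⟫ = t / 2) : x = edgePoint v w a t := by
  have h0 : ⟪a, w⟫ - ⟪a, v⟫ ≠ 0 := sub_ne_zero.2 hvw.symm
  rw [segment_eq_image'] at hx
  obtain ⟨θ, -, rfl⟩ := hx
  rw [edgePoint_eq hvw, ← hax, inner_add_right, inner_smul_right, inner_sub_right]
  congr 2
  field_simp
  ring

end EdgePoints

section SlabVertices

variable {d : ℕ} {ι : Type*} {h : ι → EuclideanSpace ℝ (Fin d)} {b : ι → ℝ}
  {P Q : Set (EuclideanSpace ℝ (Fin d))} {a u v w x : EuclideanSpace ℝ (Fin d)} {t : ℝ}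

lemma extremePoint_eq_of_mem_openSegment (hu : u ∈ P.extremePoints ℝ)
    (hv : v ∈ P.extremePoints ℝ) (hw : w ∈ P) (hxu : x ∈ openSegment ℝ u w)
    (hxv : x ∈ openSegment ℝ v w) : u = v := by
  have aux : ∀ {u v : EuclideanSpace ℝ (Fin d)} {r s : ℝ}, u ∈ P.extremePoints ℝ →
      v ∈ P.extremePoints ℝ → 0 < r → r ≤ s → r • (u - w) = s • (v - w) → u = v := by
    intro u v r s hu hv hr hrs heq
    have hs : 0 < s := hr.trans_le hrs
    have hvw : v = w + (r / s) • (u - w) := by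
      rw [div_eq_inv_mul, mul_smul, heq, inv_smul_smul₀ hs.ne']
      abel
    rcases hrs.lt_or_eq with hlt | rfl
    · refine hv.2 hu.1 hw ⟨r / s, 1 - r / s, by positivity, ?_, by ring, ?_⟩
      · rw [sub_pos]; exact (div_lt_one hs).2 hlt
      · rw [hvw]; module
    · rw [div_self hr.ne', one_smul] at hvw
      rw [hvw]; abel
  obtain ⟨r, r', hr, -, hrr, hx⟩ := hxu
  obtain ⟨s, s', hs, -, hss, hx'⟩ := hxv
  have heq : r • (u - w) = s • (v - w) := by
    obtain rfl : r' = 1 - r := by linarith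
    obtain rfl : s' = 1 - s := by linarith
    have h1 : x - w = r • (u - w) := by rw [← hx]; module
    have h2 : x - w = s • (v - w) := by rw [← hx']; module
    rw [← h1, ← h2]
  rcases le_total r s with hrs | hrs
  · exact aux hu hv hr hrs heq
  · exact (aux hv hu hs hrs heq.symm).symm

/-- A vertex of `Q` on a hyperplane section `Q ∩ {⟨a, x⟩ = t / 2} = P ∩ {⟨a, x⟩ = t / 2}` of a
polytope `P` without vertices on this hyperplane is the intersection of the hyperplane with an
edge. The edge is the smallest face of `P` containing the vertex: every segment in this face that
crosses the hyperplane has to cross it at the given point. -/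
lemma exists_edge_of_extremePoint [Finite ι] (hc : IsCompact (poly h b)) (hQ : Q ⊆ poly h b)
    (hlevel : ∀ z ∈ poly h b, ⟪a, z⟫ = t / 2 → z ∈ Q)
    (hgen : ∀ v ∈ vertices (poly h b), ⟪a, v⟫ ≠ t / 2) (hx : x ∈ Q.extremePoints ℝ)
    (hax : ⟪a, x⟫ = t / 2) :
    ∃ v w, IsEdge (poly h b) v w ∧ ⟪a, v⟫ < t / 2 ∧ t / 2 < ⟪a, w⟫ ∧ x = edgePoint v w a t := by
  set F := tightFace h b {i | ⟪h i, x⟫ = b i} with hFdef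
  have hF : IsExposed ℝ (poly h b) F := isExposed_tightFace _
  have hxF : x ∈ F := ⟨hQ hx.1, fun i hi => hi⟩
  have hFconv : Convex ℝ F := hF.convex convex_poly
  have hhull := exposed_eq_convexHull hc convex_poly finite_extremePoints_poly hF
  have hcross : ∀ z ∈ F, ⟪a, z⟫ = t / 2 → z = x := by
    intro z hz haz
    obtain ⟨ε, hε, hm⟩ := exists_add_smul_mem_poly (u := x - z) (hQ hx.1) fun i hi => by
      rw [inner_sub_right, hi, hz.2 i hi, sub_self]
    refine hx.2 (hlevel z hz.1 haz) (hlevel _ hm ?_) (mem_openSegment_add_smul_sub hε)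
    rw [inner_add_right, inner_smul_right, inner_sub_right, hax, haz]
    ring
  have hbelow : ∃ v ∈ F ∩ (poly h b).extremePoints ℝ, ⟪a, v⟫ < t / 2 := by
    by_contra! hcon
    have hsub : F ⊆ {z | t / 2 < innerSL ℝ a z} := by
      rw [hhull]
      refine convexHull_min (fun v hv => ?_) (convex_halfSpace_gt (innerSL ℝ a).isLinear _)
      exact lt_of_le_of_ne (hcon v hv) (hgen v hv.2).symm
    exact (hsub hxF).ne' hax
  have habove : ∃ w ∈ F ∩ (poly h b).extremePoints ℝ, t / 2 < ⟪a, w⟫ := by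
    by_contra! hcon
    have hsub : F ⊆ {z | innerSL ℝ a z < t / 2} := by
      rw [hhull]
      refine convexHull_min (fun v hv => ?_) (convex_halfSpace_lt (innerSL ℝ a).isLinear _)
      exact lt_of_le_of_ne (hcon v hv) (hgen v hv.2)
    exact (hsub hxF).ne hax
  obtain ⟨v, hv, hav⟩ := hbelow
  obtain ⟨w, hw, haw⟩ := habove
  have hseg : ∀ v' ∈ F, ∀ w' ∈ F, ⟪a, v'⟫ < t / 2 → t / 2 < ⟪a, w'⟫ →
      x = edgePoint v' w' a t ∧ x ∈ openSegment ℝ v' w' := by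
    intro v' hv' w' hw' hav' haw'
    have h1 := edgePoint_mem_openSegment hav' haw'
    have h2 : edgePoint v' w' a t = x :=
      hcross _ (hFconv.openSegment_subset hv' hw' h1) (inner_edgePoint (by linarith))
    exact ⟨h2.symm, h2 ▸ h1⟩
  have hpair : F ∩ (poly h b).extremePoints ℝ = {v, w} := by
    refine Subset.antisymm (fun u hu => ?_) (by rintro u (rfl | rfl) <;> assumption)
    rcases (hgen u hu.2).lt_or_gt with hau | hau
    · exact .inl (extremePoint_eq_of_mem_openSegment hu.2 hv.2 hw.2.1
        (hseg u hu.1 w hw.1 hau haw).2 (hseg v hv.1 w hw.1 hav haw).2)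
    · refine .inr (extremePoint_eq_of_mem_openSegment (x := x) hu.2 hw.2 hv.2.1 ?_ ?_)
      · rw [openSegment_symm]; exact (hseg v hv.1 u hu.1 hav hau).2
      · rw [openSegment_symm]; exact (hseg v hv.1 w hw.1 hav haw).2
  refine ⟨v, w, ⟨hv.2, hw.2, ?_, ?_⟩, hav, haw, (hseg v hv.1 w hw.1 hav haw).1⟩
  · rintro rfl; linarith
  · rw [← convexHull_pair, ← hpair, ← hhull]; exact hF

/-- The intersection of an edge with a supporting hyperplane of `Q ⊆ P` is a vertex of `Q`. -/
lemma edgePoint_mem_extremePoints (hQ : Q ⊆ P) (he : IsEdge P v w) (hav : ⟪a, v⟫ < t / 2)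
    (haw : t / 2 < ⟪a, w⟫) (hmem : edgePoint v w a t ∈ Q)
    (hside : (∀ z ∈ Q, ⟪a, z⟫ ≤ t / 2) ∨ ∀ z ∈ Q, t / 2 ≤ ⟪a, z⟫) :
    edgePoint v w a t ∈ Q.extremePoints ℝ := by
  refine ⟨hmem, fun y hy z hz hyz => ?_⟩
  have hlev : ⟪a, edgePoint v w a t⟫ = t / 2 := inner_edgePoint (by linarith)
  have hin := openSegment_subset_segment ℝ _ _ (edgePoint_mem_openSegment hav haw)
  have hy' : y ∈ segment ℝ v w := he.2.2.2.isExtreme.2 (hQ hy) (hQ hz) hin hyz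
  refine eq_edgePoint_of_mem_segment (by linarith) hy' ?_
  obtain ⟨r, s, hr, hs, hrs, hx⟩ := hyz
  rw [← hx, inner_add_right, inner_smul_right, inner_smul_right] at hlev
  obtain rfl : s = 1 - r := by linarith
  rcases hside with hside | hside
  · nlinarith [hside y hy, hside z hz]
  · nlinarith [hside y hy, hside z hz]

end SlabVertices

/-! ### Slabs with generic parameters -/

section GenericSlabs

variable {d : ℕ} {P : Set (EuclideanSpace ℝ (Fin d))}

/-- The two hyperplanes bounding the slab with parameter `y` are distinct and contain no vertices
of `P`. -/
structure IsGenericFor (P : Set (EuclideanSpace ℝ (Fin d))) (y : EuclideanSpace ℝ (Fin d) × ℝ) :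
    Prop where
  pos : 0 < y.2
  ne : ∀ v ∈ vertices P, ⟪y.1, v⟫ ≠ y.2 / 2
  ne' : ∀ v ∈ vertices P, ⟪y.1, v⟫ ≠ -y.2 / 2

/-- The bounding hyperplanes of the slabs with parameters `y` and `z` have the same vertices of
`P` on their positive sides. -/
def SameSides (P : Set (EuclideanSpace ℝ (Fin d))) (y z : EuclideanSpace ℝ (Fin d) × ℝ) : Prop :=
  ∀ v ∈ vertices P, (y.2 / 2 < ⟪y.1, v⟫ ↔ z.2 / 2 < ⟪z.1, v⟫) ∧
    (-y.2 / 2 < ⟪y.1, v⟫ ↔ -z.2 / 2 < ⟪z.1, v⟫)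

/-- The part of `P` between the hyperplanes `⟨a, x⟩ = ± t / 2`, where `y = (a, t)`. -/
def slabOf (P : Set (EuclideanSpace ℝ (Fin d))) (y : EuclideanSpace ℝ (Fin d) × ℝ) :
    Set (EuclideanSpace ℝ (Fin d)) :=
  {x | x ∈ P ∧ |⟪y.1, x⟫| ≤ y.2 / 2}

/-- A vertex of `P` strictly between the bounding hyperplanes of the slab. -/
def IsInnerVertex (P : Set (EuclideanSpace ℝ (Fin d))) (y : EuclideanSpace ℝ (Fin d) × ℝ)
    (v : EuclideanSpace ℝ (Fin d)) : Prop :=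
  v ∈ vertices P ∧ -y.2 / 2 < ⟪y.1, v⟫ ∧ ⟪y.1, v⟫ < y.2 / 2

/-- An edge of `P`, oriented so that it crosses `⟨a, x⟩ = t / 2` from below, where
`y = (a, t)`. -/
def IsCrossingEdge (P : Set (EuclideanSpace ℝ (Fin d))) (y : EuclideanSpace ℝ (Fin d) × ℝ)
    (e : EuclideanSpace ℝ (Fin d) × EuclideanSpace ℝ (Fin d)) : Prop :=
  IsEdge P e.1 e.2 ∧ ⟪y.1, e.1⟫ < y.2 / 2 ∧ y.2 / 2 < ⟪y.1, e.2⟫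

/-- Labels for the vertices of the slab with parameter `y = (a, t)`: the vertices of `P` inside
the slab, the edges crossing `⟨a, x⟩ = t / 2` and the edges crossing `⟨a, x⟩ = -t / 2`. -/
abbrev VertexLabel (P : Set (EuclideanSpace ℝ (Fin d))) (y : EuclideanSpace ℝ (Fin d) × ℝ) :
    Type :=
  {v // IsInnerVertex P y v} ⊕ {e // IsCrossingEdge P y e} ⊕ {e // IsCrossingEdge P (y.1, -y.2) e}

/-- The point of the slab with parameter `z` that a label stands for. -/
noncomputable def labelPoint {y : EuclideanSpace ℝ (Fin d) × ℝ} (k : VertexLabel P y)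
    (z : EuclideanSpace ℝ (Fin d) × ℝ) : EuclideanSpace ℝ (Fin d) :=
  Sum.elim (fun v => v.1) (Sum.elim (fun e => edgePoint e.1.1 e.1.2 z.1 z.2)
    fun e => edgePoint e.1.1 e.1.2 z.1 (-z.2)) k

lemma isVertexFormula_labelPoint {y : EuclideanSpace ℝ (Fin d) × ℝ} (k : VertexLabel P y) :
    IsVertexFormula P (labelPoint k) := by
  rcases k with v | e | e
  · exact .inl ⟨v.1, v.2.1, fun _ => rfl⟩
  · exact .inr ⟨e.1.1, e.1.2, e.2.1, .inl fun _ => rfl⟩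
  · exact .inr ⟨e.1.1, e.1.2, e.2.1, .inr fun _ => rfl⟩

lemma finite_vertexLabel (hV : (vertices P).Finite) (y : EuclideanSpace ℝ (Fin d) × ℝ) :
    Finite (VertexLabel P y) := by
  have h1 : Finite {v // IsInnerVertex P y v} := (hV.subset fun v hv => hv.1 : Set.Finite _)
  have h2 : ∀ z, Finite {e // IsCrossingEdge P z e} := fun z =>
    ((hV.prod hV).subset fun e he => ⟨he.1.1, he.1.2.1⟩ : Set.Finite _)
  have := h2 y
  have := h2 (y.1, -y.2)
  infer_instance

variable {y z : EuclideanSpace ℝ (Fin d) × ℝ}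

lemma IsInnerVertex.of_sameSides {v : EuclideanSpace ℝ (Fin d)} (hv : IsInnerVertex P y v)
    (hz : IsGenericFor P z) (hs : SameSides P y z) : IsInnerVertex P z v :=
  ⟨hv.1, (hs v hv.1).2.1 hv.2.1, lt_of_le_of_ne
    (not_lt.1 fun h => hv.2.2.not_gt ((hs v hv.1).1.2 h)) (hz.ne v hv.1)⟩

lemma IsCrossingEdge.of_sameSides {e : EuclideanSpace ℝ (Fin d) × EuclideanSpace ℝ (Fin d)}
    (he : IsCrossingEdge P y e) (hz : IsGenericFor P z) (hs : SameSides P y z) :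
    IsCrossingEdge P z e :=
  ⟨he.1, lt_of_le_of_ne (not_lt.1 fun h => he.2.1.not_gt ((hs _ he.1.1).1.2 h)) (hz.ne _ he.1.1),
    (hs _ he.1.2.1).1.1 he.2.2⟩

lemma IsCrossingEdge.of_sameSides_neg {e : EuclideanSpace ℝ (Fin d) × EuclideanSpace ℝ (Fin d)}
    (he : IsCrossingEdge P (y.1, -y.2) e) (hz : IsGenericFor P z) (hs : SameSides P y z) :
    IsCrossingEdge P (z.1, -z.2) e :=
  ⟨he.1, lt_of_le_of_ne (not_lt.1 fun h => he.2.1.not_gt ((hs _ he.1.1).2.2 h)) (hz.ne' _ he.1.1),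
    (hs _ he.1.2.1).2.1 he.2.2⟩

lemma IsCrossingEdge.inner_edgePoint {e : EuclideanSpace ℝ (Fin d) × EuclideanSpace ℝ (Fin d)}
    (he : IsCrossingEdge P y e) : ⟪y.1, edgePoint e.1 e.2 y.1 y.2⟫ = y.2 / 2 :=
  SlabChambers.inner_edgePoint (he.2.1.trans he.2.2).ne

/-- Different crossing edges give different points, since edges of a polytope do not cross. -/
lemma IsCrossingEdge.eq_of_edgePoint_eq
    {e f : EuclideanSpace ℝ (Fin d) × EuclideanSpace ℝ (Fin d)}
    (he : IsCrossingEdge P y e) (hf : IsCrossingEdge P y f)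
    (hef : edgePoint e.1 e.2 y.1 y.2 = edgePoint f.1 f.2 y.1 y.2) : e = f := by
  have hin : edgePoint f.1 f.2 y.1 y.2 ∈ segment ℝ e.1 e.2 :=
    hef ▸ openSegment_subset_segment ℝ _ _ (edgePoint_mem_openSegment he.2.1 he.2.2)
  have hopen := edgePoint_mem_openSegment hf.2.1 hf.2.2
  have hext := he.1.2.2.2.isExtreme
  have h1 : f.1 ∈ segment ℝ e.1 e.2 := hext.2 hf.1.1.1 hf.1.2.1.1 hin hopen
  have h2 : f.2 ∈ segment ℝ e.1 e.2 :=
    hext.right_mem_of_mem_openSegment hf.1.1.1 hf.1.2.1.1 hin hopen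
  have key : ∀ g ∈ vertices P, g ∈ segment ℝ e.1 e.2 → g = e.1 ∨ g = e.2 := by
    intro g hg hgs
    have : g ∈ (convexHull ℝ {e.1, e.2}).extremePoints ℝ := by
      rw [convexHull_pair]
      exact inter_extremePoints_subset_extremePoints_of_subset hext.1 ⟨hgs, hg⟩
    simpa using extremePoints_convexHull_subset this
  have h3 := he.2
  have h4 := hf.2
  ext1
  · rcases key _ hf.1.1 h1 with h | h
    · exact h.symm
    · rw [h] at h4; linarith [h4.1, h3.2]
  · rcases key _ hf.1.2.1 h2 with h | h
    · rw [h] at h4; linarith [h4.2, h3.1]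
    · exact h.symm

lemma mem_openSegment_inner_eq_iff {E : Type*} [NormedAddCommGroup E] [InnerProductSpace ℝ E]
    {u v w x : E} {c : ℝ} (hv : ⟪u, v⟫ ≤ c) (hw : ⟪u, w⟫ ≤ c) (hx : x ∈ openSegment ℝ v w) :
    ⟪u, x⟫ = c ↔ ⟪u, v⟫ = c ∧ ⟪u, w⟫ = c := by
  obtain ⟨r, s, hr, hs, hrs, rfl⟩ := hx
  rw [inner_add_right, inner_smul_right, inner_smul_right]
  obtain rfl : s = 1 - r := by linarith
  constructor
  · intro h
    constructor <;> nlinarith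
  · rintro ⟨h1, h2⟩
    rw [h1, h2]; ring

/-- Labels of a parameter on the same sides give pairwise different points. -/
lemma injective_labelPoint (hz : IsGenericFor P z) (hs : SameSides P y z) :
    Function.Injective fun k : VertexLabel P y => labelPoint k z := by
  have hpos := hz.pos
  have l1 : ∀ v : {v // IsInnerVertex P y v}, -z.2 / 2 < ⟪z.1, (v : EuclideanSpace ℝ (Fin d))⟫ ∧
      ⟪z.1, (v : EuclideanSpace ℝ (Fin d))⟫ < z.2 / 2 := fun v => (v.2.of_sameSides hz hs).2
  have l2 : ∀ e : {e // IsCrossingEdge P y e}, ⟪z.1, edgePoint e.1.1 e.1.2 z.1 z.2⟫ = z.2 / 2 :=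
    fun e => (e.2.of_sameSides hz hs).inner_edgePoint
  have l3 : ∀ e : {e // IsCrossingEdge P (y.1, -y.2) e},
      ⟪z.1, edgePoint e.1.1 e.1.2 z.1 (-z.2)⟫ = -z.2 / 2 :=
    fun e => (e.2.of_sameSides_neg hz hs).inner_edgePoint
  rintro (v | e | e) (v' | e' | e') heq <;>
    simp only [labelPoint, Sum.elim_inl, Sum.elim_inr] at heq
  · rw [Subtype.ext heq]
  · have := l1 v; have := l2 e'; rw [heq] at *; linarith
  · have := l1 v; have := l3 e'; rw [heq] at *; linarith
  · have := l1 v'; have := l2 e; rw [heq] at *; linarith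
  · rw [Subtype.ext ((e.2.of_sameSides hz hs).eq_of_edgePoint_eq (e'.2.of_sameSides hz hs) heq)]
  · have := l2 e; have := l3 e'; rw [heq] at *; linarith
  · have := l1 v'; have := l3 e; rw [heq] at *; linarith
  · have := l3 e; have := l2 e'; rw [heq] at *; linarith
  · rw [Subtype.ext ((e.2.of_sameSides_neg hz hs).eq_of_edgePoint_eq
      (e'.2.of_sameSides_neg hz hs) heq)]

/-- A generic slab has as vertices the vertices of the polytope inside the slab and the
intersections of edges with the bounding hyperplanes. -/
lemma range_labelPoint {ι : Type*} [Finite ι] {h : ι → EuclideanSpace ℝ (Fin d)} {b : ι → ℝ}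
    (hc : IsCompact (poly h b)) (hy : IsGenericFor (poly h b) y) (hz : IsGenericFor (poly h b) z)
    (hs : SameSides (poly h b) y z) :
    range (fun k : VertexLabel (poly h b) y => labelPoint k z) =
      vertices (slabOf (poly h b) z) := by
  have hpos := hz.pos
  have hsub : slabOf (poly h b) z ⊆ poly h b := fun x hx => hx.1
  have hs' : SameSides (poly h b) z y := fun v hv => ⟨(hs v hv).1.symm, (hs v hv).2.symm⟩
  apply Subset.antisymm
  · rintro _ ⟨v | e | e, rfl⟩
    · have hv := v.2.of_sameSides hz hs
      refine inter_extremePoints_subset_extremePoints_of_subset hsub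
        ⟨⟨hv.1.1, abs_le.2 ⟨?_, hv.2.2.le⟩⟩, hv.1⟩
      simp only [labelPoint, Sum.elim_inl]
      linarith [hv.2.1]
    · have he := e.2.of_sameSides hz hs
      refine edgePoint_mem_extremePoints hsub he.1 he.2.1 he.2.2 ⟨?_, ?_⟩
        (.inl fun x hx => (abs_le.1 hx.2).2)
      · exact convex_poly.openSegment_subset he.1.1.1 he.1.2.1.1
          (edgePoint_mem_openSegment he.2.1 he.2.2)
      · rw [he.inner_edgePoint, abs_of_pos (by linarith)]
    · have he := e.2.of_sameSides_neg hz hs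
      refine edgePoint_mem_extremePoints hsub he.1 he.2.1 he.2.2 ⟨?_, ?_⟩
        (.inr fun x hx => by linarith [(abs_le.1 hx.2).1])
      · exact convex_poly.openSegment_subset he.1.1.1 he.1.2.1.1
          (edgePoint_mem_openSegment he.2.1 he.2.2)
      · rw [he.inner_edgePoint, abs_of_neg (by simp only; linarith)]
        simp only; linarith
  · intro x hx
    have hax := abs_le.1 hx.1.2
    rcases hax.2.lt_or_eq with hlt | heq
    · rcases hax.1.lt_or_eq with hgt | heq
      · -- Near a point in the open slab, the slab coincides with `P`.
        have hxV : x ∈ vertices (poly h b) := by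
          refine ⟨hx.1.1, fun p hp q hq hpq => ?_⟩
          have hopen : IsOpen {p : EuclideanSpace ℝ (Fin d) | |⟪z.1, p⟫| < z.2 / 2} :=
            isOpen_lt (by fun_prop) continuous_const
          have hnhds : {p : EuclideanSpace ℝ (Fin d) | |⟪z.1, p⟫| < z.2 / 2} ∈ 𝓝 x :=
            hopen.mem_nhds (abs_lt.2 ⟨hgt, hlt⟩)
          have hlim : ∀ p : EuclideanSpace ℝ (Fin d),
              ∀ᶠ ε in 𝓝[>] (0 : ℝ), |⟪z.1, x + ε • (p - x)⟫| < z.2 / 2 := by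
            intro p
            have hcont : Continuous fun ε : ℝ => x + ε • (p - x) := by fun_prop
            have := (hcont.tendsto 0).mono_left (nhdsWithin_le_nhds (s := Ioi 0))
            simp only [zero_smul, add_zero] at this
            exact this.eventually hnhds
          obtain ⟨ε, ⟨⟨h1, h2⟩, h3⟩, h4⟩ := (((hlim p).and (hlim q)).and
            (Ioo_mem_nhdsGT one_pos)).and self_mem_nhdsWithin |>.exists
          have hin : ∀ p ∈ poly h b, |⟪z.1, x + ε • (p - x)⟫| < z.2 / 2 →
              x + ε • (p - x) ∈ slabOf (poly h b) z := fun p hp h =>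
            ⟨convex_poly.add_smul_sub_mem hx.1.1 hp ⟨h3.1.le, h3.2.le⟩, h.le⟩
          have hmem : x ∈ openSegment ℝ (x + ε • (p - x)) (x + ε • (q - x)) := by
            obtain ⟨r, s, hr, hs, hrs, hx'⟩ := hpq
            refine ⟨r, s, hr, hs, hrs, ?_⟩
            have : r • (x + ε • (p - x)) + s • (x + ε • (q - x)) =
                (r + s) • x + ε • ((r • p + s • q) - (r + s) • x) := by module
            rw [this, hx', hrs, one_smul, sub_self, smul_zero, add_zero]
          have := hx.2 (hin p hp h1) (hin q hq h2) hmem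
          simpa [sub_eq_zero, h3.1.ne'] using this
        have hi : IsInnerVertex (poly h b) z x := ⟨hxV, by linarith, hlt⟩
        exact ⟨.inl ⟨x, hi.of_sameSides hy hs'⟩, rfl⟩
      · obtain ⟨v, w, he, hv, hw, rfl⟩ := exists_edge_of_extremePoint (a := z.1) (t := -z.2) hc hsub
          (fun p hp hap => ⟨hp, by rw [hap, abs_of_neg (by linarith)]; linarith⟩) hz.ne' hx
          (by rw [← heq]; ring)
        have hce : IsCrossingEdge (poly h b) (z.1, -z.2) (v, w) := ⟨he, hv, hw⟩
        exact ⟨.inr (.inr ⟨(v, w), hce.of_sameSides_neg hy hs'⟩), rfl⟩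
    · obtain ⟨v, w, he, hv, hw, rfl⟩ := exists_edge_of_extremePoint (a := z.1) (t := z.2) hc hsub
        (fun p hp hap => ⟨hp, by rw [hap, abs_of_pos (by linarith)]⟩) hz.ne hx heq
      have hce : IsCrossingEdge (poly h b) z (v, w) := ⟨he, hv, hw⟩
      exact ⟨.inr (.inl ⟨(v, w), hce.of_sameSides hy hs'⟩), rfl⟩

section Constraints

variable {ι : Type*} {h : ι → EuclideanSpace ℝ (Fin d)} {b : ι → ℝ}

/-- Normal vectors of a slab of the polyhedron `poly h b`. -/
def slabNormal (h : ι → EuclideanSpace ℝ (Fin d)) (y : EuclideanSpace ℝ (Fin d) × ℝ) :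
    ι ⊕ Bool → EuclideanSpace ℝ (Fin d) :=
  Sum.elim h fun s => cond s y.1 (-y.1)

/-- Right-hand sides of the inequalities of a slab of the polyhedron `poly h b`. -/
noncomputable def slabBound (b : ι → ℝ) (y : EuclideanSpace ℝ (Fin d) × ℝ) : ι ⊕ Bool → ℝ :=
  Sum.elim b fun _ => y.2 / 2

lemma slabOf_poly (y : EuclideanSpace ℝ (Fin d) × ℝ) :
    slabOf (poly h b) y = poly (slabNormal h y) (slabBound b y) := by
  ext x
  simp only [slabOf, poly, slabNormal, slabBound, mem_ofPred_eq, Sum.forall, Sum.elim_inl,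
    Sum.elim_inr, Bool.forall_bool, cond_true, cond_false, inner_neg_left, abs_le]
  refine and_congr_right fun _ => ⟨fun h => ⟨by linarith [h.1], h.2⟩,
    fun h => ⟨by linarith [h.1], h.2⟩⟩

/-- The incidences between the labelled vertices and the constraints of a slab, described without
reference to the parameter. -/
lemma labelPoint_incidence (hz : IsGenericFor (poly h b) z) (hs : SameSides (poly h b) y z)
    (m : ι ⊕ Bool) (k : VertexLabel (poly h b) y) :
    ⟪slabNormal h z m, labelPoint k z⟫ = slabBound b z m ↔
      Sum.elim (fun i => Sum.elim (fun v => ⟪h i, v.1⟫ = b i) (Sum.elim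
        (fun e => ⟪h i, e.1.1⟫ = b i ∧ ⟪h i, e.1.2⟫ = b i)
        (fun e => ⟪h i, e.1.1⟫ = b i ∧ ⟪h i, e.1.2⟫ = b i)) k)
        (fun s => Sum.elim (fun _ => False) (Sum.elim (fun _ => s = true) fun _ => s = false) k)
        m := by
  have hpos := hz.pos
  rcases m with i | s
  · rcases k with v | e | e <;>
      simp only [slabNormal, slabBound, labelPoint, Sum.elim_inl, Sum.elim_inr]
    · have he := e.2.of_sameSides hz hs
      exact mem_openSegment_inner_eq_iff (he.1.1.1 i) (he.1.2.1.1 i)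
        (edgePoint_mem_openSegment he.2.1 he.2.2)
    · have he := e.2.of_sameSides_neg hz hs
      exact mem_openSegment_inner_eq_iff (he.1.1.1 i) (he.1.2.1.1 i)
        (edgePoint_mem_openSegment he.2.1 he.2.2)
  · rcases k with v | e | e <;>
      simp only [slabNormal, slabBound, labelPoint, Sum.elim_inl, Sum.elim_inr]
    · have hv := v.2.of_sameSides hz hs
      have h1 := hv.2.1
      have h2 := hv.2.2
      cases s <;> simp only [cond_true, cond_false, inner_neg_left, iff_false] <;>
        intro <;> linarith
    · have he := (e.2.of_sameSides hz hs).inner_edgePoint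
      cases s <;> simp only [cond_true, cond_false, inner_neg_left, he,
        Bool.false_eq_true, iff_false]
      intro; linarith
    · have he := (e.2.of_sameSides_neg hz hs).inner_edgePoint
      simp only at he
      cases s <;> simp only [cond_true, cond_false, inner_neg_left, he, iff_true,
        Bool.true_eq_false, iff_false]
      · ring
      · intro; linarith

/-- The sets of labels that span faces are the same for all generic parameters on the same
sides. -/
lemma isExposed_labelPoint_iff [Finite ι] (hc : IsCompact (poly h b))
    {y y' z : EuclideanSpace ℝ (Fin d) × ℝ} (hy : IsGenericFor (poly h b) y)
    (hy' : IsGenericFor (poly h b) y') (hz : IsGenericFor (poly h b) z)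
    (hs' : SameSides (poly h b) y y') (hs : SameSides (poly h b) y z)
    (σ : Set (VertexLabel (poly h b) y)) :
    IsExposed ℝ (slabOf (poly h b) y') (convexHull ℝ ((fun k => labelPoint k y') '' σ)) ↔
      IsExposed ℝ (slabOf (poly h b) z) (convexHull ℝ ((fun k => labelPoint k z) '' σ)) := by
  have hcomp : ∀ z, IsCompact (poly (slabNormal h z) (slabBound b z)) := by
    intro z
    rw [← slabOf_poly]
    have : slabOf (poly h b) z = poly h b ∩ {x | |⟪z.1, x⟫| ≤ z.2 / 2} := rfl
    rw [this]
    exact hc.inter_right (isClosed_le (by fun_prop) continuous_const)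
  have hr := range_labelPoint hc hy hz hs
  have hr' := range_labelPoint hc hy hy' hs'
  rw [slabOf_poly] at hr hr' ⊢
  rw [slabOf_poly, isExposed_convexHull_iff (hcomp z) (injective_labelPoint hz hs) hr,
    isExposed_convexHull_iff (hcomp y') (injective_labelPoint hy' hs') hr']
  simp only [labelPoint_incidence hz hs, labelPoint_incidence hy' hs']

end Constraints

end GenericSlabs

/-! ### The volume of a simplex cut by a hyperplane -/

section CutSimplex

open scoped Nat

/-- The truncated power `z ↦ z₊ ^ n`, with `z₊ ^ 0` the indicator of `z > 0`. -/
noncomputable def truncPow (n : ℕ) (z : ℝ) : ℝ := if 0 < z then z ^ n else 0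

lemma monotone_truncPow (n : ℕ) : Monotone (truncPow n) := by
  intro x y hxy
  unfold truncPow
  split_ifs with h1 h2 h2
  · gcongr
  · linarith
  · positivity
  · rfl

lemma integral_truncPow (n : ℕ) (x y : ℝ) :
    ∫ z in x..y, truncPow n z = (truncPow (n + 1) y - truncPow (n + 1) x) / (n + 1) := by
  have hint : ∀ x y, IntervalIntegrable (truncPow n) volume x y := fun x y =>
    (monotone_truncPow n).intervalIntegrable
  have h0 : ∀ y, ∫ z in (0 : ℝ)..y, truncPow n z = truncPow (n + 1) y / (n + 1) := by
    intro y
    rcases le_or_gt y 0 with hy | hy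
    · have : ∫ z in (0 : ℝ)..y, truncPow n z = ∫ z in (0 : ℝ)..y, (0 : ℝ) := by
        refine intervalIntegral.integral_congr fun z hz => ?_
        rw [uIcc_of_ge hy] at hz
        simp [truncPow, not_lt.2 hz.2]
      rw [this]
      simp [truncPow, not_lt.2 hy]
    · have : ∫ z in (0 : ℝ)..y, truncPow n z = ∫ z in (0 : ℝ)..y, z ^ n := by
        rw [intervalIntegral.integral_of_le hy.le, intervalIntegral.integral_of_le hy.le]
        refine setIntegral_congr_fun measurableSet_Ioc fun z hz => ?_
        simp [truncPow, hz.1]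
      rw [this, integral_pow]
      simp [truncPow, hy]
  rw [← intervalIntegral.integral_interval_sub_left (hint 0 y) (hint 0 x), h0, h0, sub_div]

lemma intervalIntegrable_truncPow_comp (n : ℕ) (p q x y : ℝ) :
    IntervalIntegrable (fun u => truncPow n (p + q * u)) volume x y := by
  rcases le_total 0 q with hq | hq
  · refine Monotone.intervalIntegrable fun u v huv => monotone_truncPow n ?_
    nlinarith
  · refine Antitone.intervalIntegrable fun u v huv => monotone_truncPow n ?_
    nlinarith

lemma integral_truncPow_comp (n : ℕ) (p r : ℝ) {q : ℝ} (hq : q ≠ 0) :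
    ∫ u in (0 : ℝ)..r, truncPow n (p + q * u) =
      (truncPow (n + 1) (p + q * r) - truncPow (n + 1) p) / ((n + 1) * q) := by
  rw [intervalIntegral.integral_comp_add_mul (truncPow n) hq p, integral_truncPow]
  have : (n : ℝ) + 1 ≠ 0 := by positivity
  simp
  field_simp

/-- The product of the differences between the node `γ i` and the other nodes. -/
def nodeProd {n : ℕ} (γ : Fin n → ℝ) (i : Fin n) : ℝ := ∏ k, if k = i then 1 else γ i - γ k

lemma nodeProd_ne_zero {n : ℕ} {γ : Fin n → ℝ} (hγ : Function.Injective γ) (i : Fin n) :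
    nodeProd γ i ≠ 0 := by
  refine Finset.prod_ne_zero_iff.2 fun k _ => ?_
  split_ifs with h
  · exact one_ne_zero
  · exact sub_ne_zero.2 fun h' => h (hγ h').symm

lemma nodeProd_succ {n : ℕ} (γ : Fin (n + 1) → ℝ) (i : Fin n) :
    nodeProd γ i.succ = (γ i.succ - γ 0) * nodeProd (fun k => γ k.succ) i := by
  simp [nodeProd, Fin.prod_univ_succ, (Fin.succ_ne_zero _).symm]

/-- The divided difference of a constant function vanishes. -/
lemma sum_inv_nodeProd {n : ℕ} {γ : Fin (n + 2) → ℝ} (hγ : Function.Injective γ) :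
    ∑ i, (nodeProd γ i)⁻¹ = 0 := by
  have h := Lagrange.coeff_eq_sum (s := Finset.univ) (v := γ) hγ.injOn
    (P := (1 : Polynomial ℝ)) (by
      rw [Polynomial.degree_one, Finset.card_univ, Fintype.card_fin]
      exact_mod_cast Nat.succ_pos _)
  rw [Finset.card_univ, Fintype.card_fin, show n + 2 - 1 = n + 1 from rfl, Polynomial.coeff_one,
    if_neg (by omega)] at h
  rw [h]
  refine Finset.sum_congr rfl fun i _ => ?_
  rw [Polynomial.eval_one, one_div, nodeProd, ← Finset.prod_erase Finset.univ (a := i) (by simp)]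
  congr 1
  refine Finset.prod_congr rfl fun k hk => ?_
  rw [if_neg (Finset.ne_of_mem_erase hk)]

/-- The points of the simplex `{x ≥ 0, ∑ x i ≤ r}` at which a given affine function is positive.
The values of the function at the vertices of the simplex are `c + r * γ i`. -/
def cutSimplex {n : ℕ} (γ : Fin (n + 1) → ℝ) (r c : ℝ) : Set (Fin n → ℝ) :=
  {x | (∀ i, 0 ≤ x i) ∧ ∑ i, x i ≤ r ∧
    0 < c + ∑ i, x i * γ i.castSucc + (r - ∑ i, x i) * γ (Fin.last n)}

/-- The volume of `cutSimplex γ r c`, as a divided difference of a truncated power. -/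
noncomputable def cutVolume {n : ℕ} (γ : Fin (n + 1) → ℝ) (r c : ℝ) : ℝ :=
  (n ! : ℝ)⁻¹ * ∑ i, truncPow n (c + r * γ i) / nodeProd γ i

lemma measurableSet_cutSimplex {n : ℕ} (γ : Fin (n + 1) → ℝ) (r c : ℝ) :
    MeasurableSet (cutSimplex γ r c) := by
  have h1 : IsClosed {x : Fin n → ℝ | ∑ i, x i ≤ r} := isClosed_le (by fun_prop) (by fun_prop)
  have h2 : IsOpen {x : Fin n → ℝ |
      0 < c + ∑ i, x i * γ i.castSucc + (r - ∑ i, x i) * γ (Fin.last n)} :=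
    isOpen_lt (by fun_prop) (by fun_prop)
  refine MeasurableSet.inter ?_ (h1.measurableSet.inter h2.measurableSet)
  have : {x : Fin n → ℝ | ∀ i, 0 ≤ x i} = Ici 0 := rfl
  exact (this ▸ isClosed_Ici).measurableSet

lemma insertNth_mem_cutSimplex {n : ℕ} (γ : Fin (n + 2) → ℝ) (r c u : ℝ) (x : Fin n → ℝ) :
    (Fin.insertNth 0 u x : Fin (n + 1) → ℝ) ∈ cutSimplex γ r c ↔
      0 ≤ u ∧ x ∈ cutSimplex (fun k => γ k.succ) (r - u) (c + u * γ 0) := by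
  simp only [cutSimplex, mem_ofPred_eq, Fin.forall_fin_succ, Fin.sum_univ_succ,
    Fin.insertNth_zero', Fin.cons_zero, Fin.cons_succ, Fin.castSucc_zero, and_assoc,
    ← Fin.succ_castSucc, ← Fin.succ_last]
  refine and_congr_right fun _ => and_congr_right fun _ => and_congr ?_ ?_
  · constructor <;> intro <;> linarith
  · rw [show ∀ S T g g' : ℝ, c + (u * g + S) + (r - (u + T)) * g' =
      c + u * g + S + (r - u - T) * g' by intros; ring]

lemma integral_cutVolume {n : ℕ} {γ : Fin (n + 2) → ℝ} (hγ : Function.Injective γ) (r c : ℝ) :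
    IntervalIntegrable (fun u => cutVolume (fun k => γ k.succ) (r - u) (c + u * γ 0))
      volume 0 r ∧
    ∫ u in (0 : ℝ)..r, cutVolume (fun k => γ k.succ) (r - u) (c + u * γ 0) =
      cutVolume γ r c := by
  have harg : ∀ (i : Fin (n + 1)) (u : ℝ), c + u * γ 0 + (r - u) * γ i.succ =
      (c + r * γ i.succ) + (γ 0 - γ i.succ) * u := fun i u => by ring
  have hint : ∀ i : Fin (n + 1), IntervalIntegrable
      (fun u => truncPow n (c + u * γ 0 + (r - u) * γ i.succ) / nodeProd (fun k => γ k.succ) i)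
      volume 0 r := fun i => by
    simp only [harg]
    exact (intervalIntegrable_truncPow_comp n _ _ 0 r).div_const _
  have hsum : IntervalIntegrable (fun u => ∑ i, truncPow n (c + u * γ 0 + (r - u) * γ i.succ) /
      nodeProd (fun k => γ k.succ) i) volume 0 r := by
    simpa [Finset.sum_fn] using IntervalIntegrable.sum Finset.univ fun i _ => hint i
  refine ⟨hsum.const_mul _, ?_⟩
  unfold cutVolume
  rw [intervalIntegral.integral_const_mul, intervalIntegral.integral_finsetSum fun i _ => hint i]
  have hne : ∀ i : Fin (n + 1), γ 0 - γ i.succ ≠ 0 := fun i =>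
    sub_ne_zero.2 fun h => Fin.succ_ne_zero i (hγ h).symm
  have hn : (n : ℝ) + 1 ≠ 0 := by positivity
  have hterm : ∀ i : Fin (n + 1),
      ∫ u in (0 : ℝ)..r, truncPow n (c + u * γ 0 + (r - u) * γ i.succ) /
        nodeProd (fun k => γ k.succ) i =
      ((n : ℝ) + 1)⁻¹ * (truncPow (n + 1) (c + r * γ i.succ) / nodeProd γ i.succ -
        truncPow (n + 1) (c + r * γ 0) * (nodeProd γ i.succ)⁻¹) := by
    intro i
    have hi := nodeProd_ne_zero (γ := fun k => γ (Fin.succ k))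
      (fun a b h => Fin.succ_injective _ (hγ h)) i
    have hi' : γ i.succ - γ 0 ≠ 0 := by rw [← neg_sub]; exact neg_ne_zero.2 (hne i)
    simp only [harg]
    rw [intervalIntegral.integral_div, integral_truncPow_comp n _ r (hne i), nodeProd_succ,
      show c + r * γ i.succ + (γ 0 - γ i.succ) * r = c + r * γ 0 by ring,
      show γ 0 - γ i.succ = -(γ i.succ - γ 0) by ring]
    field_simp
    ring
  have hL := sum_inv_nodeProd hγ
  rw [Fin.sum_univ_succ] at hL
  rw [Finset.sum_congr rfl fun i _ => hterm i, ← Finset.mul_sum, Finset.sum_sub_distrib,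
    ← Finset.mul_sum, Fin.sum_univ_succ (n := n + 1), Nat.factorial_succ, Nat.cast_mul, mul_inv,
    show ∑ i : Fin (n + 1), (nodeProd γ i.succ)⁻¹ = -(nodeProd γ 0)⁻¹ by linarith]
  push_cast
  ring

/-- The volume of a simplex cut by a hyperplane. The proof is an induction on the dimension,
slicing by the first coordinate. -/
lemma volume_cutSimplex {n : ℕ} {γ : Fin (n + 1) → ℝ} (hγ : Function.Injective γ) {r : ℝ}
    (hr : 0 ≤ r) (c : ℝ) :
    0 ≤ cutVolume γ r c ∧ volume (cutSimplex γ r c) = ENNReal.ofReal (cutVolume γ r c) := by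
  induction n generalizing r c with
  | zero =>
    have hset : cutSimplex γ r c = if 0 < c + r * γ 0 then univ else ∅ := by
      ext x
      split_ifs with h <;> simp [cutSimplex, hr, h]
    have hvol : cutVolume γ r c = if 0 < c + r * γ 0 then 1 else 0 := by
      simp [cutVolume, truncPow, nodeProd]
    rw [hset, hvol]
    split_ifs with h <;> simp [volume_pi]
  | succ n ih =>
    have hγ' : Function.Injective fun k : Fin (n + 1) => γ k.succ :=
      fun a b h => Fin.succ_injective _ (hγ h)
    obtain ⟨hint, hval⟩ := integral_cutVolume hγ r c
    have hnonneg : ∀ u ∈ Icc 0 r, 0 ≤ cutVolume (fun k => γ k.succ) (r - u) (c + u * γ 0) :=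
      fun u hu => (ih hγ' (sub_nonneg.2 hu.2) _).1
    refine ⟨?_, ?_⟩
    · rw [← hval]
      exact intervalIntegral.integral_nonneg hr hnonneg
    set e := MeasurableEquiv.piFinSuccAbove (fun _ : Fin (n + 1) => ℝ) 0
    have hmp : MeasurePreserving e.symm :=
      (volume_preserving_piFinSuccAbove (fun _ : Fin (n + 1) => ℝ) 0).symm
    have hslice : ∀ u : ℝ,
        volume (Prod.mk u ⁻¹' (e.symm ⁻¹' cutSimplex γ r c)) =
        (Icc 0 r).indicator (fun u => ENNReal.ofReal
          (cutVolume (fun k => γ k.succ) (r - u) (c + u * γ 0))) u := by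
      intro u
      have hpre : Prod.mk u ⁻¹' (e.symm ⁻¹' cutSimplex γ r c) =
          {x | 0 ≤ u ∧ x ∈ cutSimplex (fun k => γ k.succ) (r - u) (c + u * γ 0)} := by
        ext x
        exact insertNth_mem_cutSimplex γ r c u x
      rw [hpre]
      by_cases hu : u ∈ Icc 0 r
      · rw [indicator_of_mem hu, ← (ih hγ' (sub_nonneg.2 hu.2) _).2]
        simp only [hu.1, true_and]
        rfl
      · rw [indicator_of_notMem hu]
        convert measure_empty (μ := (volume : Measure (Fin n → ℝ)))
        ext x
        simp only [mem_ofPred_eq, mem_empty_iff_false, iff_false]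
        rintro ⟨h0, hx⟩
        have h1 : 0 ≤ ∑ i, x i := Finset.sum_nonneg fun i _ => hx.1 i
        exact hu ⟨h0, by linarith [hx.2.1]⟩
    rw [← hmp.measure_preimage (measurableSet_cutSimplex γ r c).nullMeasurableSet,
      Measure.volume_eq_prod, Measure.prod_apply (hmp.measurable (measurableSet_cutSimplex γ r c))]
    refine (lintegral_congr hslice).trans ?_
    rw [lintegral_indicator measurableSet_Icc, ← hval, intervalIntegral.integral_of_le hr,
      ← integral_Icc_eq_integral_Ioc, ofReal_integral_eq_lintegral_ofReal]
    · exact (intervalIntegrable_iff_integrableOn_Icc_of_le hr).1 hint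
    · exact (ae_restrict_iff' measurableSet_Icc).2 (ae_of_all _ hnonneg)

end CutSimplex

/-! ### Regular triangulations -/

section Triangulation

variable {d : ℕ} {ι : Type*}

lemma volume_hyperplane {a : EuclideanSpace ℝ (Fin d)} (ha : a ≠ 0) (s : ℝ) :
    volume {x : EuclideanSpace ℝ (Fin d) | ⟪a, x⟫ = s} = 0 := by
  rcases eq_empty_or_nonempty {x : EuclideanSpace ℝ (Fin d) | ⟪a, x⟫ = s} with h | ⟨x₀, hx₀⟩
  · rw [h, measure_empty]
  have hx₀ : ⟪a, x₀⟫ = s := hx₀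
  let S : AffineSubspace ℝ (EuclideanSpace ℝ (Fin d)) :=
    AffineSubspace.mk' x₀ (LinearMap.ker (innerSL ℝ a).toLinearMap)
  have hS : ∀ x, x ∈ S ↔ ⟪a, x⟫ = s := by
    intro x
    rw [AffineSubspace.mem_mk', LinearMap.mem_ker]
    simp [inner_sub_right, hx₀, sub_eq_zero]
  have hne : S ≠ ⊤ := by
    intro htop
    have h1 : ⟪a, x₀ + a⟫ = s := (hS _).1 (htop ▸ AffineSubspace.mem_top ℝ _ _)
    rw [inner_add_right, hx₀] at h1
    exact ha (inner_self_eq_zero (𝕜 := ℝ).1 (by linarith))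
  convert Measure.addHaar_affineSubspace volume S hne using 2
  ext x
  exact (hS x).symm

/-- The convex hull of at most `d` points of `ℝ^d` is a null set. -/
lemma volume_convexHull_image_eq_zero (p : ι → EuclideanSpace ℝ (Fin d)) {A : Finset ι}
    (hA : A.card ≤ d) : volume (convexHull ℝ (p '' A)) = 0 := by
  classical
  rcases A.eq_empty_or_nonempty with rfl | hne
  · simp
  refine measure_mono_null (convexHull_subset_affineSpan _)
    (Measure.addHaar_affineSubspace volume _ fun htop => ?_)
  have h1 := finrank_vectorSpan_image_finset_le ℝ p A
    (n := A.card - 1) (by have := hne.card_pos; omega)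
  rw [Finset.coe_image, ← direction_affineSpan, htop, AffineSubspace.direction_top, finrank_top,
    finrank_euclideanSpace_fin] at h1
  have := hne.card_pos
  omega

/-- Heights `ω` for the points `p` are generic if no `d + 2` of the lifted points `(p i, ω i)` lie
on a common nonvertical hyperplane. -/
def IsGenericHeight (p : ι → EuclideanSpace ℝ (Fin d)) (ω : ι → ℝ) : Prop :=
  ∀ U : Finset ι, U.card = d + 2 → ¬ ∃ (c : EuclideanSpace ℝ (Fin d)) (e : ℝ),
    ∀ u ∈ U, ⟪c, p u⟫ + e = ω u

lemma exists_isGenericHeight [Finite ι] (p : ι → EuclideanSpace ℝ (Fin d)) :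
    ∃ ω, IsGenericHeight p ω := by
  classical
  have := Fintype.ofFinite ι
  let L : ∀ U : Finset ι, EuclideanSpace ℝ (Fin d) × ℝ →ₗ[ℝ] (U → ℝ) := fun U =>
    LinearMap.pi fun u => ((innerSL ℝ (p u)).toLinearMap).coprod LinearMap.id
  let B : {U : Finset ι // U.card = d + 2} → Submodule ℝ (ι → ℝ) := fun U =>
    (LinearMap.range (L U)).comap (LinearMap.funLeft ℝ ℝ ((↑) : U.1 → ι))
  obtain ⟨ω, hω⟩ := Submodule.exists_forall_notMem_of_forall_ne_top B fun U htop => by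
    have hsurj : Function.Surjective (L U) := by
      intro g
      obtain ⟨f, hf⟩ := LinearMap.funLeft_surjective_of_injective ℝ ℝ ((↑) : U.1 → ι)
        Subtype.val_injective g
      have : f ∈ B U := htop ▸ Submodule.mem_top
      rw [Submodule.mem_comap, hf] at this
      exact this
    have := LinearMap.finrank_le_finrank_of_surjective hsurj
    rw [Module.finrank_prod, finrank_euclideanSpace_fin, Module.finrank_self,
      Module.finrank_fintype_fun_eq_card, Fintype.card_coe, U.2] at this
    omega
  refine ⟨ω, fun U hU ⟨c, e, h⟩ => hω ⟨U, hU⟩ ?_⟩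
  rw [Submodule.mem_comap]
  refine ⟨(c, e), funext fun u => ?_⟩
  simpa [L, real_inner_comm] using h u u.2

/-- A cell of the regular subdivision with heights `ω`: the `d + 1` points at which some affine
function below `ω` touches `ω`. -/
def IsLowerCell (p : ι → EuclideanSpace ℝ (Fin d)) (ω : ι → ℝ) (T : Finset ι) : Prop :=
  T.card = d + 1 ∧ ∃ (c : EuclideanSpace ℝ (Fin d)) (e : ℝ), (∀ i, ⟪c, p i⟫ + e ≤ ω i) ∧
    ∀ i, i ∈ T ↔ ⟪c, p i⟫ + e = ω i

/-- Two cells meet in a subset of the hyperplane on which their affine functions agree. -/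
lemma volume_inter_lowerCell {p : ι → EuclideanSpace ℝ (Fin d)} {ω : ι → ℝ} {T T' : Finset ι}
    (hT : IsLowerCell p ω T) (hT' : IsLowerCell p ω T') (hne : T ≠ T') :
    volume (convexHull ℝ (p '' T) ∩ convexHull ℝ (p '' T')) = 0 := by
  obtain ⟨-, c, e, hle, hmem⟩ := hT
  obtain ⟨-, c', e', hle', hmem'⟩ := hT'
  have key : ∀ {T : Finset ι} {c c' : EuclideanSpace ℝ (Fin d)} {e e' : ℝ},
      (∀ i ∈ T, ⟪c, p i⟫ + e = ω i) → (∀ i, ⟪c', p i⟫ + e' ≤ ω i) →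
      ∀ x ∈ convexHull ℝ (p '' T), ⟪c' - c, x⟫ ≤ e - e' := by
    intro T c c' e e' h h' x hx
    have hsub : p '' T ⊆ {x | innerSL ℝ (c' - c) x ≤ e - e'} := by
      rintro _ ⟨i, hi, rfl⟩
      have h1 := h i hi
      have h2 := h' i
      simp only [mem_ofPred_eq, innerSL_apply_apply, inner_sub_left]
      linarith
    exact convexHull_min hsub (convex_halfSpace_le (innerSL ℝ (c' - c)).isLinear _) hx
  have hsub : convexHull ℝ (p '' T) ∩ convexHull ℝ (p '' T') ⊆ {x | ⟪c' - c, x⟫ = e - e'} := by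
    rintro x ⟨hx, hx'⟩
    have h1 := key (fun i hi => (hmem i).1 hi) hle' x hx
    have h2 := key (fun i hi => (hmem' i).1 hi) hle x hx'
    rw [← neg_sub, inner_neg_left] at h2
    exact le_antisymm h1 (by linarith)
  refine measure_mono_null hsub ?_
  by_cases hc : c' - c = 0
  · convert measure_empty (μ := (volume : Measure (EuclideanSpace ℝ (Fin d))))
    ext x
    simp only [hc, inner_zero_left, mem_ofPred_eq, mem_empty_iff_false, iff_false]
    intro he
    obtain rfl : c' = c := sub_eq_zero.1 hc
    obtain rfl : e = e' := by linarith
    exact hne (Finset.ext fun i => (hmem i).trans (hmem' i).symm)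
  · exact volume_hyperplane hc _

/-- The cells cover the polytope up to a null set. The cell containing `x` consists of the points
touched by the affine function below `ω` with the largest value at `x`; otherwise a functional
separating `x` from these points could be used to increase the value. -/
lemma exists_lowerCell [Finite ι] {p : ι → EuclideanSpace ℝ (Fin d)} {ω : ι → ℝ}
    (hω : IsGenericHeight p ω) {x : EuclideanSpace ℝ (Fin d)}
    (hx : x ∈ interior (convexHull ℝ (range p)))
    (hx' : ∀ A : Finset ι, A.card ≤ d → x ∉ convexHull ℝ (p '' A)) :
    ∃ T, IsLowerCell p ω T ∧ x ∈ convexHull ℝ (p '' T) := by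
  classical
  have := Fintype.ofFinite ι
  have : Nonempty ι := by
    have := (⟨x, interior_subset hx⟩ : (convexHull ℝ (range p)).Nonempty)
    exact range_nonempty_iff_nonempty.1 (convexHull_nonempty_iff.1 this)
  let F : EuclideanSpace ℝ (Fin d) → ℝ := fun c =>
    Finset.univ.inf' Finset.univ_nonempty fun i => ω i + ⟪c, x - p i⟫
  have hF : Continuous F := Continuous.finset_inf'_apply _ fun i _ => by fun_prop
  have hlim : Tendsto F (cocompact _) atBot := by
    obtain ⟨δ, hδ, hball⟩ := Metric.nhds_basis_closedBall.mem_iff.1 (mem_interior_iff_mem_nhds.1 hx)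
    have hbound : ∀ c, F c ≤ (∑ i, |ω i|) + -δ * ‖c‖ := by
      intro c
      obtain ⟨i, hi⟩ : ∃ i, ⟪c, x⟫ + δ * ‖c‖ ≤ ⟪c, p i⟫ := by
        by_contra! hcon
        have hsub : convexHull ℝ (range p) ⊆ {z | innerSL ℝ c z < ⟪c, x⟫ + δ * ‖c‖} := by
          refine convexHull_min ?_ (convex_halfSpace_lt (innerSL ℝ c).isLinear _)
          rintro _ ⟨i, rfl⟩
          exact hcon i
        have hmem : x + (δ / ‖c‖) • c ∈ Metric.closedBall x δ := by
          rw [mem_closedBall_iff_norm, add_sub_cancel_left, norm_smul, Real.norm_eq_abs,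
            abs_of_nonneg (by positivity)]
          rcases eq_or_ne ‖c‖ 0 with h | h
          · simp [h, hδ.le]
          · rw [div_mul_cancel₀ _ h]
        have h1 := hsub (hball hmem)
        simp only [mem_ofPred_eq, innerSL_apply_apply, inner_add_right, inner_smul_right,
          real_inner_self_eq_norm_sq] at h1
        rcases eq_or_ne c 0 with rfl | hc
        · simp at h1
        · have : ‖c‖ ≠ 0 := norm_ne_zero_iff.2 hc
          rw [sq, ← mul_assoc, div_mul_cancel₀ _ this] at h1
          exact lt_irrefl _ h1
      refine (Finset.inf'_le _ (Finset.mem_univ i)).trans ?_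
      have h1 : ω i ≤ ∑ j, |ω j| := (le_abs_self _).trans
        (Finset.single_le_sum (f := fun j => |ω j|) (fun j _ => abs_nonneg _) (Finset.mem_univ i))
      rw [inner_sub_right]
      linarith
    refine tendsto_atBot_mono hbound (tendsto_atBot_add_const_left _ _ ?_)
    exact (tendsto_norm_cocompact_atTop (E := EuclideanSpace ℝ (Fin d))).const_mul_atTop_of_neg
      (neg_neg_of_pos hδ)
  obtain ⟨c, hc⟩ := hF.exists_forall_ge hlim
  set e := F c - ⟪c, x⟫ with he
  have hval : ∀ i, ω i + ⟪c, x - p i⟫ = F c + (ω i - (⟪c, p i⟫ + e)) := fun i => by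
    rw [inner_sub_right, he]; ring
  have hle : ∀ i, ⟪c, p i⟫ + e ≤ ω i := by
    intro i
    have h1 : F c ≤ ω i + ⟪c, x - p i⟫ := Finset.inf'_le _ (Finset.mem_univ i)
    rw [hval] at h1
    linarith
  let T : Finset ι := Finset.univ.filter fun i => ⟪c, p i⟫ + e = ω i
  have hmemT : ∀ i, i ∈ T ↔ ⟪c, p i⟫ + e = ω i := fun i => by simp [T]
  have hxT : x ∈ convexHull ℝ (p '' T) := by
    by_contra hnot
    have hcl : IsClosed (convexHull ℝ (p '' T)) :=
      ((T.finite_toSet.image p).isCompact_convexHull (𝕜 := ℝ)).isClosed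
    obtain ⟨f, u, hfu, hux⟩ := geometric_hahn_banach_closed_point (convex_convexHull ℝ _) hcl hnot
    set g := (InnerProductSpace.toDual ℝ (EuclideanSpace ℝ (Fin d))).symm f
    have hg : ∀ z, ⟪g, z⟫ = f z := fun z => InnerProductSpace.toDual_symm_apply
    have hev : ∀ᶠ ε in 𝓝[>] (0 : ℝ), ∀ i, F c < ω i + ⟪c + ε • g, x - p i⟫ := by
      rw [eventually_all]
      intro i
      by_cases hi : i ∈ T
      · filter_upwards [self_mem_nhdsWithin] with ε hε
        have h1 : 0 < ⟪g, x - p i⟫ := by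
          rw [hg, map_sub]
          linarith [hfu _ (subset_convexHull ℝ _ (mem_image_of_mem p hi))]
        rw [inner_add_left, inner_smul_left, ← add_assoc, hval, (hmemT i).1 hi, sub_self, add_zero]
        have : 0 < ε * ⟪g, x - p i⟫ := mul_pos hε h1
        simpa using this
      · have hcont : Continuous fun ε : ℝ => ω i + ⟪c + ε • g, x - p i⟫ := by fun_prop
        have h1 : Tendsto (fun ε : ℝ => ω i + ⟪c + ε • g, x - p i⟫) (𝓝[>] 0)
            (𝓝 (ω i + ⟪c, x - p i⟫)) := by
          simpa using (hcont.tendsto 0).mono_left nhdsWithin_le_nhds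
        refine h1.eventually_const_lt ?_
        rw [hval]
        have := lt_of_le_of_ne (hle i) fun h => hi ((hmemT i).2 h)
        linarith
    obtain ⟨ε, hε⟩ := hev.exists
    exact (hc (c + ε • g)).not_gt ((Finset.lt_inf'_iff _).2 fun i _ => hε i)
  refine ⟨T, ⟨le_antisymm ?_ ?_, c, e, hle, hmemT⟩, hxT⟩
  · by_contra! hcard
    obtain ⟨U, hUT, hU⟩ := Finset.exists_subset_card_eq (show d + 2 ≤ T.card from hcard)
    exact hω U hU ⟨c, e, fun u hu => (hmemT u).1 (hUT hu)⟩
  · by_contra! hcard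
    exact hx' T (by omega) hxT

/-- A polytope with vertices among the points `p` is decomposed by finitely many simplices with
vertices among the points `p`. -/
lemma exists_triangulation [Finite ι] (p : ι → EuclideanSpace ℝ (Fin d)) :
    ∃ 𝒯 : Finset (Finset ι), (∀ T ∈ 𝒯, T.card = d + 1) ∧ ∀ A, MeasurableSet A →
      volume (convexHull ℝ (range p) ∩ A) = ∑ T ∈ 𝒯, volume (convexHull ℝ (p '' T) ∩ A) := by
  classical
  have := Fintype.ofFinite ι
  obtain ⟨ω, hω⟩ := exists_isGenericHeight p
  refine ⟨Finset.univ.filter (IsLowerCell p ω), fun T hT => (Finset.mem_filter.1 hT).2.1,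
    fun A hA => ?_⟩
  have hmeas : ∀ T : Finset ι, MeasurableSet (convexHull ℝ (p '' T)) := fun T =>
    ((T.finite_toSet.image p).isCompact_convexHull (𝕜 := ℝ)).isClosed.measurableSet
  rw [← measure_biUnion_finset₀ (μ := volume)]
  · refine measure_congr ?_
    refine EventuallyLE.antisymm ?_ ?_
    · have h1 : ∀ᵐ x : EuclideanSpace ℝ (Fin d), x ∉ frontier (convexHull ℝ (range p)) :=
        measure_eq_zero_iff_ae_notMem.1 ((convex_convexHull ℝ _).addHaar_frontier volume)
      have h2 : ∀ᵐ x : EuclideanSpace ℝ (Fin d), ∀ A : Finset ι,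
          A.card ≤ d → x ∉ convexHull ℝ (p '' A) := by
        rw [ae_all_iff]
        intro A
        by_cases hA : A.card ≤ d
        · filter_upwards [measure_eq_zero_iff_ae_notMem.1
            (volume_convexHull_image_eq_zero p hA)] with x hx _ using hx
        · exact ae_of_all _ fun x h => absurd h hA
      filter_upwards [h1, h2] with x hx1 hx2 hx
      have hint : x ∈ interior (convexHull ℝ (range p)) := by
        by_contra hn
        exact hx1 ⟨subset_closure hx.1, hn⟩
      obtain ⟨T, hT, hxT⟩ := exists_lowerCell hω hint hx2
      exact mem_biUnion (by simpa using hT) ⟨hxT, hx.2⟩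
    · refine Eventually.of_forall fun x hx => ?_
      obtain ⟨T, -, hxT⟩ := mem_iUnion₂.1 hx
      exact ⟨convexHull_mono (image_subset_range _ _) hxT.1, hxT.2⟩
  · intro T hT T' hT' hne
    refine measure_mono_null (inter_subset_inter inter_subset_left inter_subset_left) ?_
    exact volume_inter_lowerCell (by simpa using hT) (by simpa using hT') hne
  · exact fun T _ => ((hmeas T).inter hA).nullMeasurableSet

end Triangulation

/-! ### Volumes cut off from polytopes -/

section SimplexVolume

variable {d : ℕ} {ι : Type*}

lemma convexHull_range_eq_image_stdSimplex {E : Type*} [AddCommGroup E] [Module ℝ E] [Fintype ι]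
    (v : ι → E) : convexHull ℝ (range v) = (fun w : ι → ℝ => ∑ i, w i • v i) '' stdSimplex ℝ ι := by
  classical
  have h : (fun w : ι → ℝ => ∑ i, w i • v i) = Fintype.linearCombination ℝ v := by
    ext w; simp [Fintype.linearCombination_apply]
  rw [h, ← convexHull_rangle_single_eq_stdSimplex, LinearMap.image_convexHull, ← range_comp]
  congr 2
  ext i
  simp

/-- The linear part of the affine map sending the standard simplex to the simplex with vertices
`v`. -/
noncomputable def edgeMap (v : Fin (d + 1) → EuclideanSpace ℝ (Fin d)) :
    EuclideanSpace ℝ (Fin d) →ₗ[ℝ] EuclideanSpace ℝ (Fin d) :=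
  ∑ i, (EuclideanSpace.proj i : EuclideanSpace ℝ (Fin d) →L[ℝ] ℝ).toLinearMap.smulRight
    (v i.castSucc - v (Fin.last d))

lemma edgeMap_apply (v : Fin (d + 1) → EuclideanSpace ℝ (Fin d)) (y : EuclideanSpace ℝ (Fin d)) :
    edgeMap v y = ∑ i, y i • (v i.castSucc - v (Fin.last d)) := by
  simp [edgeMap]

lemma convexHull_inter_halfSpace_eq (v : Fin (d + 1) → EuclideanSpace ℝ (Fin d))
    (a : EuclideanSpace ℝ (Fin d)) (s : ℝ) :
    convexHull ℝ (range v) ∩ {x | s < ⟪a, x⟫} = (fun x => v (Fin.last d) + x) ''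
      (edgeMap v '' (WithLp.ofLp ⁻¹' cutSimplex (fun i => ⟪a, v i⟫) 1 (-s))) := by
  have hpt : ∀ y : EuclideanSpace ℝ (Fin d), v (Fin.last d) + edgeMap v y =
      ∑ i : Fin d, y i • v i.castSucc + (1 - ∑ i, y i) • v (Fin.last d) := by
    intro y
    rw [edgeMap_apply]
    simp only [smul_sub, Finset.sum_sub_distrib, ← Finset.sum_smul, sub_smul, one_smul]
    abel
  have hin : ∀ y : EuclideanSpace ℝ (Fin d), ⟪a, v (Fin.last d) + edgeMap v y⟫ =
      ∑ i : Fin d, y i * ⟪a, v i.castSucc⟫ + (1 - ∑ i, y i) * ⟪a, v (Fin.last d)⟫ := by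
    intro y
    rw [hpt, inner_add_right, inner_sum, inner_smul_right]
    simp only [inner_smul_right]
  rw [image_image, convexHull_range_eq_image_stdSimplex]
  ext x
  constructor
  · rintro ⟨⟨w, ⟨hw, hw1⟩, rfl⟩, hx⟩
    rw [Fin.sum_univ_castSucc] at hw1
    have hlast : w (Fin.last d) = 1 - ∑ i : Fin d, w i.castSucc := by linarith
    have hxeq : v (Fin.last d) + edgeMap v (WithLp.toLp 2 fun i => w i.castSucc) =
        ∑ i, w i • v i := by
      rw [hpt, Fin.sum_univ_castSucc, hlast]
    refine ⟨WithLp.toLp 2 fun i => w i.castSucc, ⟨fun i => hw _, ?_, ?_⟩, hxeq⟩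
    · change ∑ i : Fin d, w i.castSucc ≤ 1
      linarith [hw (Fin.last d)]
    · have hx : s < ⟪a, ∑ i, w i • v i⟫ := hx
      rw [← hxeq, hin] at hx
      change 0 < -s + _ + _
      linarith
  · rintro ⟨y, ⟨h0, h1, h2⟩, rfl⟩
    refine ⟨⟨Fin.snoc (α := fun _ => ℝ) y (1 - ∑ i, y i), ⟨fun i => ?_, ?_⟩, ?_⟩, ?_⟩
    · refine Fin.lastCases ?_ (fun i => ?_) i
      · simpa using h1
      · simpa using h0 i
    · simp [Fin.sum_univ_castSucc]
    · simp only [Fin.sum_univ_castSucc, Fin.snoc_castSucc, Fin.snoc_last]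
      exact (hpt y).symm
    · change s < ⟪a, v (Fin.last d) + edgeMap v y⟫
      rw [hin]
      linarith

/-- The volume cut off from a simplex by a half-space whose bounding direction separates the
vertices. The formula also covers degenerate simplices, for which the determinant vanishes. -/
lemma volume_convexHull_inter_halfSpace (v : Fin (d + 1) → EuclideanSpace ℝ (Fin d))
    {a : EuclideanSpace ℝ (Fin d)} (ha : Function.Injective fun i => ⟪a, v i⟫) (s : ℝ) :
    volume.real (convexHull ℝ (range v) ∩ {x | s < ⟪a, x⟫}) =
      |LinearMap.det (edgeMap v)| * cutVolume (fun i => ⟪a, v i⟫) 1 (-s) := by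
  obtain ⟨h0, hvol⟩ := volume_cutSimplex ha zero_le_one (-s)
  rw [convexHull_inter_halfSpace_eq, measureReal_def, image_add_left, measure_preimage_add,
    Measure.addHaar_image_linearMap, (PiLp.volume_preserving_ofLp (Fin d)).measure_preimage
      (measurableSet_cutSimplex _ _ _).nullMeasurableSet, hvol, ENNReal.toReal_mul,
    ENNReal.toReal_ofReal (abs_nonneg _), ENNReal.toReal_ofReal h0]

/-- The volume cut off from a polytope by a half-space is a linear combination of the volumes cut
off from simplices, with coefficients that do not depend on the half-space. -/
lemma exists_volume_inter_halfSpace_eq {V : Set (EuclideanSpace ℝ (Fin d))} (hV : V.Finite) :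
    ∃ (m : ℕ) (v : Fin m → Fin (d + 1) → EuclideanSpace ℝ (Fin d)) (D : Fin m → ℝ),
      (∀ k, Function.Injective (v k)) ∧ (∀ k i, v k i ∈ V) ∧
      ∀ (a : EuclideanSpace ℝ (Fin d)) (s : ℝ), InjOn (fun x => ⟪a, x⟫) V →
        volume.real (convexHull ℝ V ∩ {x | s < ⟪a, x⟫}) =
          ∑ k, D k * cutVolume (fun i => ⟪a, v k i⟫) 1 (-s) := by
  classical
  have := hV.to_subtype
  obtain ⟨𝒯, hcard, hvol⟩ := exists_triangulation ((↑) : V → EuclideanSpace ℝ (Fin d))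
  let e : ∀ T : 𝒯, Fin (d + 1) ≃ T.1 := fun T => (T.1.equivFinOfCardEq (hcard T.1 T.2)).symm
  let w : 𝒯 → Fin (d + 1) → EuclideanSpace ℝ (Fin d) := fun T i => (e T i).1.1
  have hinj : ∀ T, Function.Injective (w T) := fun T i j hij =>
    (e T).injective (Subtype.ext (Subtype.ext hij))
  have hmem : ∀ T i, w T i ∈ V := fun T i => (e T i).1.2
  have hrange : ∀ T : 𝒯, range (w T) = ((↑) : V → EuclideanSpace ℝ (Fin d)) '' T.1 := by
    intro T
    ext x
    constructor
    · rintro ⟨i, rfl⟩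
      exact ⟨_, (e T i).2, rfl⟩
    · rintro ⟨u, hu, rfl⟩
      exact ⟨(e T).symm ⟨u, hu⟩, by simp [w]⟩
  let f := 𝒯.equivFin
  refine ⟨𝒯.card, fun k => w (f.symm k), fun k => |LinearMap.det (edgeMap (w (f.symm k)))|,
    fun k => hinj _, fun k => hmem _, fun a s ha => ?_⟩
  have hmeas : MeasurableSet {x : EuclideanSpace ℝ (Fin d) | s < ⟪a, x⟫} :=
    (isOpen_lt continuous_const (by fun_prop)).measurableSet
  have h1 := hvol _ hmeas
  rw [Subtype.range_coe] at h1
  have hfin : ∀ T : Finset V, volume (convexHull ℝ (((↑) : V → EuclideanSpace ℝ (Fin d)) '' T) ∩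
      {x | s < ⟪a, x⟫}) ≠ ⊤ := fun T => measure_ne_top_of_subset inter_subset_left
    ((T.finite_toSet.image _).isCompact_convexHull (𝕜 := ℝ)).measure_lt_top.ne
  rw [measureReal_def, h1, ENNReal.toReal_sum fun T _ => hfin T,
    Equiv.sum_comp f.symm (fun T => |LinearMap.det (edgeMap (w T))| *
      cutVolume (fun i => ⟪a, w T i⟫) 1 (-s)), ← Finset.sum_coe_sort 𝒯]
  refine Finset.sum_congr rfl fun T _ => ?_
  rw [← volume_convexHull_inter_halfSpace (w T)
    (fun i j hij => hinj T (ha (hmem T i) (hmem T j) hij)) s, hrange]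
  rfl

end SimplexVolume

/-! ### Rational functions -/

section Rational

variable {d : ℕ} {C : Set (EuclideanSpace ℝ (Fin d) × ℝ)}
  {f g : EuclideanSpace ℝ (Fin d) × ℝ → ℝ}

lemma polyVal_add (p q : MvPolynomial (Option (Fin d)) ℝ) (y : EuclideanSpace ℝ (Fin d) × ℝ) :
    polyVal (p + q) y = polyVal p y + polyVal q y :=
  map_add _ p q

lemma polyVal_mul (p q : MvPolynomial (Option (Fin d)) ℝ) (y : EuclideanSpace ℝ (Fin d) × ℝ) :
    polyVal (p * q) y = polyVal p y * polyVal q y :=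
  map_mul _ p q

/-- The function `f` has a rational formula on `C`. -/
def HasRationalFormula (C : Set (EuclideanSpace ℝ (Fin d) × ℝ))
    (f : EuclideanSpace ℝ (Fin d) × ℝ → ℝ) : Prop :=
  ∃ p q, IsRationalFormula C f p q

namespace HasRationalFormula

lemma of_polyVal (p : MvPolynomial (Option (Fin d)) ℝ) (h : ∀ y ∈ C, f y = polyVal p y) :
    HasRationalFormula C f :=
  ⟨p, 1, fun y hy => by simp [h y hy, polyVal]⟩

lemma congr (hf : HasRationalFormula C f) (h : ∀ y ∈ C, g y = f y) : HasRationalFormula C g := by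
  obtain ⟨p, q, hpq⟩ := hf
  exact ⟨p, q, fun y hy => ⟨(hpq y hy).1, (h y hy).trans (hpq y hy).2⟩⟩

lemma const (c : ℝ) : HasRationalFormula C fun _ => c :=
  of_polyVal (MvPolynomial.C c) fun y _ => by simp [polyVal]

lemma coord (i : Fin d) : HasRationalFormula C fun y => y.1 i :=
  of_polyVal (MvPolynomial.X (some i)) fun y _ => by simp [polyVal]

lemma snd : HasRationalFormula C fun y => y.2 :=
  of_polyVal (MvPolynomial.X none) fun y _ => by simp [polyVal]

lemma add (hf : HasRationalFormula C f) (hg : HasRationalFormula C g) :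
    HasRationalFormula C fun y => f y + g y := by
  obtain ⟨p, q, hpq⟩ := hf
  obtain ⟨p', q', hpq'⟩ := hg
  refine ⟨p * q' + q * p', q * q', fun y hy => ?_⟩
  obtain ⟨h1, h2⟩ := hpq y hy
  obtain ⟨h3, h4⟩ := hpq' y hy
  simp only [polyVal_add, polyVal_mul, h2, h4]
  exact ⟨mul_ne_zero h1 h3, div_add_div _ _ h1 h3⟩

lemma mul (hf : HasRationalFormula C f) (hg : HasRationalFormula C g) :
    HasRationalFormula C fun y => f y * g y := by
  obtain ⟨p, q, hpq⟩ := hf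
  obtain ⟨p', q', hpq'⟩ := hg
  refine ⟨p * p', q * q', fun y hy => ?_⟩
  obtain ⟨h1, h2⟩ := hpq y hy
  obtain ⟨h3, h4⟩ := hpq' y hy
  simp only [polyVal_mul, h2, h4]
  exact ⟨mul_ne_zero h1 h3, div_mul_div_comm _ _ _ _⟩

lemma inv (hf : HasRationalFormula C f) (h0 : ∀ y ∈ C, f y ≠ 0) :
    HasRationalFormula C fun y => (f y)⁻¹ := by
  obtain ⟨p, q, hpq⟩ := hf
  refine ⟨q, p, fun y hy => ?_⟩
  obtain ⟨h1, h2⟩ := hpq y hy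
  refine ⟨fun h => h0 y hy (by rw [h2, h, zero_div]), ?_⟩
  change (f y)⁻¹ = _
  rw [h2, inv_div]

lemma div (hf : HasRationalFormula C f) (hg : HasRationalFormula C g) (h0 : ∀ y ∈ C, g y ≠ 0) :
    HasRationalFormula C fun y => f y / g y := by
  simpa only [div_eq_mul_inv] using hf.mul (hg.inv h0)

lemma neg (hf : HasRationalFormula C f) : HasRationalFormula C fun y => -f y := by
  simpa only [neg_one_mul] using (const (-1)).mul hf

lemma sub (hf : HasRationalFormula C f) (hg : HasRationalFormula C g) :
    HasRationalFormula C fun y => f y - g y := by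
  simpa only [sub_eq_add_neg] using hf.add hg.neg

lemma sum {κ : Type*} (s : Finset κ) {f : κ → EuclideanSpace ℝ (Fin d) × ℝ → ℝ}
    (hf : ∀ k, HasRationalFormula C (f k)) : HasRationalFormula C fun y => ∑ k ∈ s, f k y := by
  classical
  induction s using Finset.induction_on with
  | empty => simpa using const 0
  | insert k s hk ih => simpa only [Finset.sum_insert hk] using (hf k).add ih

lemma prod {κ : Type*} (s : Finset κ) {f : κ → EuclideanSpace ℝ (Fin d) × ℝ → ℝ}
    (hf : ∀ k, HasRationalFormula C (f k)) : HasRationalFormula C fun y => ∏ k ∈ s, f k y := by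
  classical
  induction s using Finset.induction_on with
  | empty => simpa using const 1
  | insert k s hk ih => simpa only [Finset.prod_insert hk] using (hf k).mul ih

lemma pow (hf : HasRationalFormula C f) (n : ℕ) : HasRationalFormula C fun y => f y ^ n := by
  simpa using prod (Finset.range n) fun _ => hf

lemma inner (v : EuclideanSpace ℝ (Fin d)) : HasRationalFormula C fun y => ⟪y.1, v⟫ := by
  have h : ∀ y : EuclideanSpace ℝ (Fin d) × ℝ, ⟪y.1, v⟫ = ∑ i, y.1 i * v i := fun y => by
    simp [PiLp.inner_apply, mul_comm]
  simp only [h]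
  exact sum _ fun i => (coord i).mul (const _)

end HasRationalFormula

end Rational

/-! ### Balls of polyhedral norms -/

section NormBall

variable {d : ℕ} {N : Seminorm ℝ (EuclideanSpace ℝ (Fin d))}

lemma IsPolyhedralNorm.exists_normBall_eq_poly (hN : IsPolyhedralNorm N) :
    ∃ (ι : Type) (_ : Finite ι) (h : ι → EuclideanSpace ℝ (Fin d)) (b : ι → ℝ),
      normBall N = poly h b := by
  obtain ⟨S, hS, hSeq⟩ := hN.polyhedral
  refine ⟨S, hS.to_subtype, fun i => i.1.1, fun i => i.1.2 / 2, ?_⟩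
  ext x
  have h1 : N x ≤ 1 / 2 ↔ (2 : ℝ) • x ∈ {x | N x ≤ 1} := by
    simp only [mem_ofPred_eq, map_smul_eq_mul, Real.norm_ofNat]
    constructor <;> intro <;> linarith
  change N x ≤ 1 / 2 ↔ _
  rw [h1, hSeq]
  simp only [poly, mem_ofPred_eq, Subtype.forall, inner_smul_right]
  refine forall₂_congr fun i _ => ?_
  constructor <;> intro <;> linarith

lemma IsPolyhedralNorm.isCompact_normBall (hN : IsPolyhedralNorm N) : IsCompact (normBall N) := by
  have hcont : Continuous N := by
    rw [← continuousOn_univ]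
    exact N.convexOn.continuousOn isOpen_univ
  refine Metric.isCompact_of_isClosed_isBounded (isClosed_le hcont continuous_const) ?_
  rcases subsingleton_or_nontrivial (EuclideanSpace ℝ (Fin d)) with _ | _
  · exact (Set.subsingleton_of_subsingleton).finite.isBounded
  obtain ⟨u, hu, hmin⟩ := (isCompact_sphere (0 : EuclideanSpace ℝ (Fin d)) 1).exists_isMinOn
    (NormedSpace.sphere_nonempty.2 zero_le_one) hcont.continuousOn
  have hu0 : u ≠ 0 := by
    rintro rfl
    simp at hu
  have hpos : 0 < N u := (apply_nonneg N u).lt_of_ne' fun h => hu0 (hN.definite u h)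
  refine (Metric.isBounded_closedBall (x := (0 : EuclideanSpace ℝ (Fin d)))
    (r := 1 / 2 / N u)).subset fun x hx => ?_
  rw [mem_closedBall_zero_iff, le_div_iff₀ hpos]
  rcases eq_or_ne x 0 with rfl | hx0
  · simp
  have hn : ‖x‖ ≠ 0 := norm_ne_zero_iff.2 hx0
  have h1 : N u ≤ N (‖x‖⁻¹ • x) := hmin (by simp [norm_smul, hn])
  rw [map_smul_eq_mul, norm_inv, norm_norm, ← div_eq_inv_mul, le_div_iff₀ (by positivity)] at h1
  have h2 : N x ≤ 1 / 2 := hx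
  linarith

lemma neg_mem_normBall {x : EuclideanSpace ℝ (Fin d)} (hx : x ∈ normBall N) :
    -x ∈ normBall N := by
  change N (-x) ≤ 1 / 2
  rw [map_neg_eq_map]
  exact hx

lemma neg_mem_vertices_normBall {v : EuclideanSpace ℝ (Fin d)}
    (hv : v ∈ vertices (normBall N)) : -v ∈ vertices (normBall N) := by
  refine ⟨neg_mem_normBall hv.1, fun x hx y hy hxy => ?_⟩
  rw [← neg_eq_iff_eq_neg]
  refine hv.2 (neg_mem_normBall hx) (neg_mem_normBall hy) ?_
  obtain ⟨r, s, hr, hs, hrs, h⟩ := hxy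
  exact ⟨r, s, hr, hs, hrs, by rw [smul_neg, smul_neg, ← neg_add, h, neg_neg]⟩

lemma slabOf_normBall (y : EuclideanSpace ℝ (Fin d) × ℝ) :
    slabOf (normBall N) y = slab N y.1 y.2 := rfl

end NormBall

/-! ### Regions and chambers -/

section Chambers

variable {d : ℕ} {P R : Set (EuclideanSpace ℝ (Fin d))} {a a' : EuclideanSpace ℝ (Fin d)}

lemma IsSweepRegion.subset (hR : IsSweepRegion P R) :
    R ⊆ Metric.sphere 0 1 \ sweepArrangement P := by
  obtain ⟨a, -, rfl⟩ := hR
  exact connectedComponentIn_subset _ _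

lemma injOn_inner_of_notMem_sweepArrangement (ha : a ∉ sweepArrangement P) :
    InjOn (fun x => ⟪a, x⟫) (vertices P) := by
  intro v hv w hw hvw
  by_contra hne
  refine ha ⟨v, hv, w, hw, hne, ?_⟩
  rw [inner_sub_right, sub_eq_zero]
  exact hvw

/-- All directions in a region order the vertices in the same way. -/
lemma IsSweepRegion.inner_lt_inner (hR : IsSweepRegion P R) (ha : a ∈ R) (ha' : a' ∈ R)
    {v w : EuclideanSpace ℝ (Fin d)} (hv : v ∈ vertices P) (hw : w ∈ vertices P)
    (h : ⟪a, w⟫ < ⟪a, v⟫) : ⟪a', w⟫ < ⟪a', v⟫ := by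
  by_contra! hcon
  have hconn : IsPreconnected R := by
    obtain ⟨a, -, rfl⟩ := hR
    exact isPreconnected_connectedComponentIn
  have hcont : Continuous fun a : EuclideanSpace ℝ (Fin d) => ⟪a, v - w⟫ := by fun_prop
  obtain ⟨c, hc, hc0⟩ := hconn.intermediate_value ha' ha hcont.continuousOn
    (show (0 : ℝ) ∈ Icc _ _ by
      simp only [inner_sub_right]
      exact ⟨by linarith, by linarith⟩)
  exact (hR.subset hc).2 ⟨v, hv, w, hw, by rintro rfl; exact lt_irrefl _ h, hc0⟩

lemma IsSweepRegion.inner_lt_inner_iff (hR : IsSweepRegion P R) (ha : a ∈ R) (ha' : a' ∈ R)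
    {v w : EuclideanSpace ℝ (Fin d)} (hv : v ∈ vertices P) (hw : w ∈ vertices P) :
    ⟪a, w⟫ < ⟪a, v⟫ ↔ ⟪a', w⟫ < ⟪a', v⟫ :=
  ⟨hR.inner_lt_inner ha ha' hv hw, hR.inner_lt_inner ha' ha hv hw⟩

lemma IsSweepRegion.positiveVertices_eq (hR : IsSweepRegion P R)
    (hsymm : ∀ v ∈ vertices P, -v ∈ vertices P) (ha : a ∈ R) (ha' : a' ∈ R) :
    positiveVertices P a = positiveVertices P a' := by
  ext v
  refine and_congr_right fun hv => ?_
  have h := hR.inner_lt_inner_iff ha ha' hv (hsymm v hv)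
  simpa only [inner_neg_right, neg_lt_self_iff] using h

/-- The positive vertices that come before `w` in the ordering induced by `a`. -/
def predecessors (P : Set (EuclideanSpace ℝ (Fin d))) (a w : EuclideanSpace ℝ (Fin d)) :
    Set (EuclideanSpace ℝ (Fin d)) :=
  {u | u ∈ positiveVertices P a ∧ ⟪a, u⟫ < ⟪a, w⟫}

/-- The vertices above the level `t / 2` are those with at least `j` predecessors; this does not
involve the parameter beyond the ordering of the vertices. -/
lemma sweepInterval_cases {j : ℕ} {t : ℝ} (ht : t ∈ sweepInterval P j a) :
    0 < t ∧ ∀ w ∈ vertices P,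
      (w ∈ positiveVertices P a ∧ j ≤ (predecessors P a w).ncard) ∧ t / 2 < ⟪a, w⟫ ∨
      ¬ (w ∈ positiveVertices P a ∧ j ≤ (predecessors P a w).ncard) ∧ ⟪a, w⟫ < t / 2 := by
  obtain ⟨hj, v, ⟨himg, hmono⟩, hlow, hup⟩ := ht
  set m := (positiveVertices P a).ncard
  have hpos : ∀ i ∈ Icc 1 m, v i ∈ positiveVertices P a := fun i hi =>
    himg ▸ mem_image_of_mem v hi
  have ht : 0 < t := by
    split_ifs at hlow with h0
    · linarith
    · have := (hpos j ⟨Nat.one_le_iff_ne_zero.2 h0, hj.le⟩).2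
      linarith
  refine ⟨ht, fun w hw => ?_⟩
  by_cases hwp : w ∈ positiveVertices P a
  · obtain ⟨i, hi, rfl⟩ := himg.symm ▸ hwp
    have hpre : predecessors P a (v i) = v '' Ico 1 i := by
      ext u
      constructor
      · rintro ⟨hu, hui⟩
        obtain ⟨k, hk, rfl⟩ := himg.symm ▸ hu
        exact ⟨k, ⟨hk.1, (hmono.lt_iff_lt hk hi).1 hui⟩, rfl⟩
      · rintro ⟨k, hk, rfl⟩
        have hk' : k ∈ Icc 1 m := ⟨hk.1, hk.2.le.trans hi.2⟩
        exact ⟨hpos k hk', hmono hk' hi hk.2⟩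
    have hinj : InjOn v (Ico 1 i) := by
      intro k hk l hl hkl
      refine hmono.injOn ⟨hk.1, hk.2.le.trans hi.2⟩ ⟨hl.1, hl.2.le.trans hi.2⟩ ?_
      simp only [hkl]
    have hcard : (predecessors P a (v i)).ncard = i - 1 := by
      rw [hpre, hinj.ncard_image, ← Finset.coe_Ico, ncard_coe_finset, Nat.card_Ico]
    have hi1 : 1 ≤ i := hi.1
    rw [hcard]
    by_cases hji : j + 1 ≤ i
    · left
      refine ⟨⟨hwp, by omega⟩, hup.trans_le ?_⟩
      exact (hmono.le_iff_le ⟨by omega, hj⟩ hi).2 hji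
    · right
      refine ⟨fun h => by omega, lt_of_le_of_lt ?_ hlow⟩
      rw [if_neg (by omega)]
      exact (hmono.le_iff_le hi ⟨by omega, hj.le⟩).2 (by omega)
  · right
    refine ⟨fun h => hwp h.1, ?_⟩
    have : ⟪a, w⟫ ≤ 0 := not_lt.1 fun h => hwp ⟨hw, h⟩
    linarith

section MaximalChamber

variable {C : Set (EuclideanSpace ℝ (Fin d) × ℝ)} {y z : EuclideanSpace ℝ (Fin d) × ℝ}

lemma IsMaximalChamber.norm_eq_one (hC : IsMaximalChamber P C) (hy : y ∈ C) : ‖y.1‖ = 1 := by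
  obtain ⟨R, hR, j, -, rfl⟩ := hC
  simpa using (hR.subset hy.1).1

lemma IsMaximalChamber.injOn_inner (hC : IsMaximalChamber P C) (hy : y ∈ C) :
    InjOn (fun x => ⟪y.1, x⟫) (vertices P) := by
  obtain ⟨R, hR, j, -, rfl⟩ := hC
  exact injOn_inner_of_notMem_sweepArrangement (hR.subset hy.1).2

lemma IsMaximalChamber.isGenericFor (hC : IsMaximalChamber P C)
    (hsymm : ∀ v ∈ vertices P, -v ∈ vertices P) (hy : y ∈ C) : IsGenericFor P y := by
  obtain ⟨R, hR, j, -, rfl⟩ := hC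
  obtain ⟨hpos, hcases⟩ := sweepInterval_cases hy.2
  have hne : ∀ v ∈ vertices P, ⟪y.1, v⟫ ≠ y.2 / 2 := fun v hv => by
    rcases hcases v hv with h | h
    · exact h.2.ne'
    · exact h.2.ne
  refine ⟨hpos, hne, fun v hv h => hne _ (hsymm v hv) ?_⟩
  rw [inner_neg_right, h]
  ring

lemma IsMaximalChamber.sameSides (hC : IsMaximalChamber P C)
    (hsymm : ∀ v ∈ vertices P, -v ∈ vertices P) (hy : y ∈ C) (hz : z ∈ C) : SameSides P y z := by
  have gy := hC.isGenericFor hsymm hy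
  have gz := hC.isGenericFor hsymm hz
  obtain ⟨R, hR, j, -, rfl⟩ := hC
  obtain ⟨-, cy⟩ := sweepInterval_cases hy.2
  obtain ⟨-, cz⟩ := sweepInterval_cases hz.2
  have hpv := hR.positiveVertices_eq hsymm hy.1 hz.1
  have hpre : ∀ w ∈ vertices P, predecessors P y.1 w = predecessors P z.1 w := by
    intro w hw
    ext u
    simp only [predecessors, mem_ofPred_eq, hpv]
    exact and_congr_right fun hu => hR.inner_lt_inner_iff hy.1 hz.1 hw hu.1
  have h1 : ∀ v ∈ vertices P, (y.2 / 2 < ⟪y.1, v⟫ ↔ z.2 / 2 < ⟪z.1, v⟫) := by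
    intro v hv
    have h2 := cy v hv
    have h3 := cz v hv
    rw [hpv, hpre v hv] at h2
    constructor <;> intro h
    · rcases h2 with h2 | h2
      · rcases h3 with h3 | h3
        · exact h3.2
        · exact absurd h2.1 h3.1
      · exact absurd h2.2 h.not_gt
    · rcases h3 with h3 | h3
      · rcases h2 with h2 | h2
        · exact h2.2
        · exact absurd h3.1 h2.1
      · exact absurd h3.2 h.not_gt
  have h2 : ∀ {y : EuclideanSpace ℝ (Fin d) × ℝ}, IsGenericFor P y → ∀ v ∈ vertices P,
      (-y.2 / 2 < ⟪y.1, v⟫ ↔ ¬ y.2 / 2 < ⟪y.1, -v⟫) := by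
    intro y gy v hv
    rw [inner_neg_right, not_lt, neg_le, ← neg_div]
    exact ⟨le_of_lt, fun h => lt_of_le_of_ne h (gy.ne' v hv).symm⟩
  refine fun v hv => ⟨h1 v hv, ?_⟩
  rw [h2 gy v hv, h2 gz v hv, h1 _ (hsymm v hv)]

end MaximalChamber

/-- Two directions that order the vertices in the same way lie in the same region, since the
normalized segment between them avoids the arrangement. -/
lemma mem_connectedComponentIn_of_inner_lt_inner
    (hV : ∃ v ∈ vertices P, ∃ w ∈ vertices P, v ≠ w)
    (ha : a ∈ Metric.sphere 0 1 \ sweepArrangement P)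
    (ha' : a' ∈ Metric.sphere 0 1 \ sweepArrangement P)
    (h : ∀ v ∈ vertices P, ∀ w ∈ vertices P, ⟪a, w⟫ < ⟪a, v⟫ → ⟪a', w⟫ < ⟪a', v⟫) :
    a' ∈ connectedComponentIn (Metric.sphere 0 1 \ sweepArrangement P) a := by
  have hcone : ∀ c ∈ segment ℝ a a', ∀ v ∈ vertices P, ∀ w ∈ vertices P, v ≠ w →
      ⟪c, v - w⟫ ≠ 0 := by
    rintro _ ⟨r, s, hr, hs, hrs, rfl⟩ v hv w hw hvw
    have hne : ⟪a, v⟫ ≠ ⟪a, w⟫ := fun he =>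
      hvw (injOn_inner_of_notMem_sweepArrangement ha.2 hv hw he)
    rw [inner_add_left, inner_smul_left, inner_smul_left]
    simp only [conj_trivial, inner_sub_right]
    obtain rfl : s = 1 - r := by linarith
    rcases hne.lt_or_gt with hlt | hlt
    · have := h w hw v hv hlt
      intro h0
      nlinarith [mul_nonneg hr (sub_nonneg.2 hlt.le), mul_nonneg hs (sub_nonneg.2 this.le)]
    · have := h v hv w hw hlt
      intro h0
      nlinarith [mul_nonneg hr (sub_nonneg.2 hlt.le), mul_nonneg hs (sub_nonneg.2 this.le)]
  have hne0 : ∀ c ∈ segment ℝ a a', c ≠ 0 := by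
    obtain ⟨v, hv, w, hw, hvw⟩ := hV
    rintro c hc rfl
    exact hcone 0 hc v hv w hw hvw (inner_zero_left _)
  have hunit : ∀ {a : EuclideanSpace ℝ (Fin d)},
      a ∈ Metric.sphere (0 : EuclideanSpace ℝ (Fin d)) 1 →
      ‖a‖⁻¹ • a = a := fun ha => by
    rw [mem_sphere_zero_iff_norm.1 ha, inv_one, one_smul]
  have hcont : ContinuousOn (fun c : EuclideanSpace ℝ (Fin d) => ‖c‖⁻¹ • c) (segment ℝ a a') :=
    (continuous_norm.continuousOn.inv₀ fun c hc => norm_ne_zero_iff.2 (hne0 c hc)).smul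
      continuousOn_id
  have hpre := (convex_segment a a').isPreconnected.image _ hcont
  refine hpre.subset_connectedComponentIn ⟨a, left_mem_segment ℝ a a', hunit ha.1⟩ ?_
    ⟨a', right_mem_segment ℝ a a', hunit ha'.1⟩
  rintro _ ⟨c, hc, rfl⟩
  have hn : ‖c‖ ≠ 0 := norm_ne_zero_iff.2 (hne0 c hc)
  refine ⟨by simp [norm_smul, hn], ?_⟩
  rintro ⟨v, hv, w, hw, hvw, h0⟩
  rw [inner_smul_left] at h0
  exact hcone c hc v hv w hw hvw ((mul_eq_zero.1 h0).resolve_left (by simpa using hn))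

lemma finite_sweepRegions (hfin : (vertices P).Finite)
    (hV : ∃ v ∈ vertices P, ∃ w ∈ vertices P, v ≠ w) : {R | IsSweepRegion P R}.Finite := by
  let f : Set (EuclideanSpace ℝ (Fin d)) →
      Set (EuclideanSpace ℝ (Fin d) × EuclideanSpace ℝ (Fin d)) := fun R =>
    {q | q ∈ vertices P ×ˢ vertices P ∧ ∃ a ∈ R, ⟪a, q.2⟫ < ⟪a, q.1⟫}
  refine Set.Finite.of_finite_image (f := f)
    ((hfin.prod hfin).finite_subsets.subset ?_) ?_
  · rintro _ ⟨R, -, rfl⟩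
    exact fun q hq => hq.1
  · intro R hR R' hR' heq
    obtain ⟨a, ha, rfl⟩ := id hR
    obtain ⟨a', ha', rfl⟩ := id hR'
    refine connectedComponentIn_eq (mem_connectedComponentIn_of_inner_lt_inner hV ha ha' ?_)
    intro v hv w hw h
    have hmem : (v, w) ∈ f (connectedComponentIn (Metric.sphere 0 1 \ sweepArrangement P) a) :=
      ⟨⟨hv, hw⟩, a, mem_connectedComponentIn ha, h⟩
    rw [heq] at hmem
    obtain ⟨-, b, hb, hlt⟩ := hmem
    exact IsSweepRegion.inner_lt_inner hR' hb (mem_connectedComponentIn ha') hv hw hlt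

lemma finite_maximalChambers (hfin : (vertices P).Finite) : {C | IsMaximalChamber P C}.Finite := by
  by_cases hV : ∃ v ∈ vertices P, ∃ w ∈ vertices P, v ≠ w
  · refine (((finite_sweepRegions hfin hV).prod (finite_Iio ((vertices P).ncard / 2))).image
      fun q => chamber P q.1 q.2).subset ?_
    rintro C ⟨R, hR, j, hj, rfl⟩
    exact ⟨(R, j), ⟨hR, hj⟩, rfl⟩
  · -- With at most one vertex there is no admissible index.
    convert finite_empty
    ext C
    simp only [mem_ofPred_eq, mem_empty_iff_false, iff_false]
    rintro ⟨R, -, j, hj, -⟩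
    have : (vertices P).ncard ≤ 1 := (ncard_le_one hfin).2 fun v hv w hw => by
      by_contra hne
      exact hV ⟨v, hv, w, hw, hne⟩
    omega

/-- A finite set can be listed by increasing values of an injective function. -/
lemma exists_increasing_enumeration {α : Type*} [Nonempty α] {s : Set α} (hs : s.Finite)
    {f : α → ℝ} (hf : InjOn f s) :
    ∃ v : ℕ → α, v '' Icc 1 s.ncard = s ∧ StrictMonoOn (fun k => f (v k)) (Icc 1 s.ncard) := by
  classical
  have hcard : (hs.toFinset.image f).card = s.ncard := by
    rw [Finset.card_image_of_injOn (by simpa using hf), ncard_eq_toFinset_card s hs]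
  let o := (hs.toFinset.image f).orderEmbOfFin hcard
  have hex : ∀ k : Fin s.ncard, ∃ u ∈ s, f u = o k := fun k => by
    obtain ⟨u, hu, huk⟩ := Finset.mem_image.1
      (Finset.orderEmbOfFin_mem (hs.toFinset.image f) hcard k)
    exact ⟨u, hs.mem_toFinset.1 hu, huk⟩
  choose g hg hgo using hex
  let v : ℕ → α := fun k => if h : k - 1 < s.ncard then g ⟨k - 1, h⟩ else Classical.arbitrary α
  have hv : ∀ k (hk : k ∈ Icc 1 s.ncard), v k = g ⟨k - 1, by have := hk.1; have := hk.2; omega⟩ :=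
    fun k hk => dif_pos _
  refine ⟨v, Subset.antisymm ?_ fun u hu => ?_, fun k hk l hl hkl => ?_⟩
  · rintro _ ⟨k, hk, rfl⟩
    rw [hv k hk]
    exact hg _
  · have : f u ∈ range o := by
      rw [Finset.range_orderEmbOfFin]
      simpa using ⟨u, hu, rfl⟩
    obtain ⟨k, hk⟩ := this
    have hk' : (k : ℕ) + 1 ∈ Icc 1 s.ncard := ⟨by omega, k.2⟩
    refine ⟨k + 1, hk', hf (hv _ hk' ▸ hg _) hu ?_⟩
    rw [hv _ hk', hgo, ← hk]
    rfl
  · simp only [hv k hk, hv l hl, hgo]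
    refine o.strictMono (Fin.mk_lt_mk.2 ?_)
    have := hk.1
    omega

/-- Generic parameters of slabs that are proper parts of the polytope lie in a chamber. -/
lemma exists_maximalChamber (hfin : (vertices P).Finite)
    (hsymm : ∀ v ∈ vertices P, -v ∈ vertices P) (hnorm : ‖a‖ = 1) (ha : a ∉ sweepArrangement P)
    {t : ℝ} (ht : 0 < t) (hne : ∀ v ∈ vertices P, ⟪a, v⟫ ≠ t / 2)
    (hex : ∃ v ∈ vertices P, t / 2 < ⟪a, v⟫) : ∃ C, IsMaximalChamber P C ∧ (a, t) ∈ C := by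
  classical
  have hsub : positiveVertices P a ⊆ vertices P := fun v hv => hv.1
  have hpfin := hfin.subset hsub
  obtain ⟨v, himg, hmono⟩ := exists_increasing_enumeration hpfin
    ((injOn_inner_of_notMem_sweepArrangement ha).mono hsub)
  set m := (positiveVertices P a).ncard with hm
  have hpos : ∀ i ∈ Icc 1 m, v i ∈ positiveVertices P a := fun i hi =>
    himg ▸ mem_image_of_mem v hi
  -- The index of the chamber is found from the first vertex above the level `t / 2`.
  have hidx : ∃ i, i ∈ Icc 1 m ∧ t / 2 < ⟪a, v i⟫ := by
    obtain ⟨w, hw, hlt⟩ := hex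
    have : w ∈ positiveVertices P a := ⟨hw, by linarith⟩
    rw [← himg] at this
    obtain ⟨i, hi, rfl⟩ := this
    exact ⟨i, hi, hlt⟩
  have hspec := Nat.find_spec hidx
  have hmin := fun k => Nat.find_min hidx (m := k)
  set i := Nat.find hidx
  obtain ⟨j, hj⟩ : ∃ j, i = j + 1 := ⟨i - 1, by have := hspec.1.1; omega⟩
  rw [hj] at hspec hmin
  have hjm : j < m := hspec.1.2
  have hcard : 2 * m ≤ (vertices P).ncard := by
    have hdisj : Disjoint (positiveVertices P a) (Neg.neg '' positiveVertices P a) := by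
      rw [disjoint_left]
      rintro _ h1 ⟨u, hu, rfl⟩
      have h2 := h1.2
      have h3 := hu.2
      rw [inner_neg_right] at h2
      linarith
    have hunion : positiveVertices P a ∪ Neg.neg '' positiveVertices P a ⊆ vertices P := by
      rintro u (hu | ⟨u, hu, rfl⟩)
      · exact hu.1
      · exact hsymm u hu.1
    have h1 := ncard_le_ncard hunion hfin
    rw [ncard_union_eq hdisj hpfin (hpfin.image _), ncard_image_of_injective _ neg_injective,
      ← hm] at h1
    omega
  have hmem : a ∈ Metric.sphere (0 : EuclideanSpace ℝ (Fin d)) 1 \ sweepArrangement P :=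
    ⟨by simpa using hnorm, ha⟩
  refine ⟨chamber P (connectedComponentIn (Metric.sphere 0 1 \ sweepArrangement P) a) j,
    ⟨_, ⟨a, hmem, rfl⟩, j, by omega, rfl⟩, mem_connectedComponentIn hmem, hjm, v,
    ⟨himg, hmono⟩, ?_, hspec.2⟩
  change _ < t / 2
  split_ifs with h0
  · linarith
  · have hjmem : j ∈ Icc 1 m := ⟨Nat.one_le_iff_ne_zero.2 h0, hjm.le⟩
    have h1 : ¬ (t / 2 < ⟪a, v j⟫) := fun h => hmin j (Nat.lt_succ_self j) ⟨hjmem, h⟩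
    exact lt_of_le_of_ne (not_lt.1 h1) (hne _ (hpos j hjmem).1)

lemma eventually_add_mul_ne_zero (p : ℝ) {q : ℝ} (hq : q ≠ 0) :
    ∀ᶠ ε in 𝓝[>] (0 : ℝ), p + ε * q ≠ 0 := by
  have h : ∀ ε : ℝ, ε ≠ -p / q → p + ε * q ≠ 0 := fun ε hε h0 =>
    hε (by rw [eq_div_iff hq]; linarith)
  rcases eq_or_ne (0 : ℝ) (-p / q) with h0 | h0
  · filter_upwards [self_mem_nhdsWithin] with ε hε using h ε (h0 ▸ (mem_Ioi.1 hε).ne')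
  · exact ((eventually_ne_nhds h0).filter_mono nhdsWithin_le_nhds).mono h

/-- Parameters of slabs that are proper parts of the polytope are limits of generic ones. -/
lemma exists_mem_closure_maximalChamber (hfin : (vertices P).Finite)
    (hsymm : ∀ v ∈ vertices P, -v ∈ vertices P) (hnorm : ‖a‖ = 1) {t : ℝ} (ht : 0 ≤ t)
    (hex : ∃ v ∈ vertices P, t / 2 < ⟪a, v⟫) :
    ∃ C, IsMaximalChamber P C ∧ (a, t) ∈ closure C := by
  obtain ⟨g, hg⟩ : ∃ g : EuclideanSpace ℝ (Fin d),
      ∀ v ∈ vertices P, ∀ w ∈ vertices P, v ≠ w → ⟪g, v - w⟫ ≠ 0 := by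
    let S := {q : EuclideanSpace ℝ (Fin d) × EuclideanSpace ℝ (Fin d) |
      q ∈ vertices P ×ˢ vertices P ∧ q.1 ≠ q.2}
    have : Finite S := ((hfin.prod hfin).subset fun q hq => hq.1 : S.Finite)
    obtain ⟨g, hg⟩ := Module.Dual.exists_forall_ne_zero_of_forall_exists
      (fun q : S => (innerSL ℝ (q.1.1 - q.1.2)).toLinearMap) fun q =>
        ⟨q.1.1 - q.1.2, inner_self_ne_zero (𝕜 := ℝ).2 (sub_ne_zero.2 q.2.2)⟩
    refine ⟨g, fun v hv w hw hvw => ?_⟩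
    rw [real_inner_comm]
    exact hg ⟨(v, w), ⟨hv, hw⟩, hvw⟩
  -- Along the curve `A` below, the level of a vertex `v` relative to the bounding hyperplane moves
  -- with speed `⟨g, v⟩ - κ`, up to normalization, and hence is nonzero for small `ε > 0`.
  obtain ⟨κ, hκ, hκg⟩ := ((Ioi_infinite (0 : ℝ)).sdiff (hfin.image fun v => ⟪g, v⟫)).nonempty
  have hκ : 0 < κ := hκ
  let n : ℝ → ℝ := fun ε => ‖a + ε • g‖
  let A : ℝ → EuclideanSpace ℝ (Fin d) × ℝ := fun ε =>
    ((n ε)⁻¹ • (a + ε • g), (n ε)⁻¹ * (t + ε * (2 * κ)))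
  have hn : Tendsto n (𝓝[>] 0) (𝓝 1) := by
    have : Continuous n := by fun_prop
    simpa [n, hnorm] using (this.tendsto 0).mono_left nhdsWithin_le_nhds
  have hlim : Tendsto A (𝓝[>] 0) (𝓝 (a, t)) := by
    have h1 : Continuous fun ε : ℝ => a + ε • g := by fun_prop
    have h2 : Continuous fun ε : ℝ => t + ε * (2 * κ) := by fun_prop
    have h3 := (hn.inv₀ one_ne_zero).smul ((h1.tendsto 0).mono_left nhdsWithin_le_nhds)
    have h4 := (hn.inv₀ one_ne_zero).mul ((h2.tendsto 0).mono_left nhdsWithin_le_nhds)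
    simp only [inv_one, zero_smul, add_zero, one_smul] at h3
    simp only [inv_one, zero_mul, add_zero, one_mul] at h4
    exact h3.prodMk_nhds h4
  have harr : ∀ᶠ ε in 𝓝[>] (0 : ℝ), ∀ v ∈ vertices P, ∀ w ∈ vertices P, v ≠ w →
      ⟪a + ε • g, v - w⟫ ≠ 0 := by
    rw [eventually_all_finite hfin]
    intro v hv
    rw [eventually_all_finite hfin]
    intro w hw
    by_cases hvw : v = w
    · exact Eventually.of_forall fun ε h => absurd hvw h
    · filter_upwards [eventually_add_mul_ne_zero ⟪a, v - w⟫ (hg v hv w hw hvw)] with ε hε _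
      simpa [inner_add_left, inner_smul_left] using hε
  have hlev : ∀ᶠ ε in 𝓝[>] (0 : ℝ), ∀ v ∈ vertices P, ⟪a + ε • g, v⟫ ≠ (t + ε * (2 * κ)) / 2 := by
    rw [eventually_all_finite hfin]
    intro v hv
    have hq : ⟪g, v⟫ - κ ≠ 0 := sub_ne_zero.2 fun h => hκg ⟨v, hv, h⟩
    filter_upwards [eventually_add_mul_ne_zero (⟪a, v⟫ - t / 2) hq] with ε hε h0
    rw [inner_add_left, inner_smul_left, conj_trivial] at h0
    exact hε (by linarith)
  obtain ⟨v₀, hv₀, hlt⟩ := hex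
  have habove : ∀ᶠ ε in 𝓝[>] (0 : ℝ), (t + ε * (2 * κ)) / 2 < ⟪a + ε • g, v₀⟫ := by
    have h1 : Continuous fun ε : ℝ => ⟪a + ε • g, v₀⟫ - (t + ε * (2 * κ)) / 2 := by fun_prop
    have h2 := (h1.tendsto 0).mono_left (nhdsWithin_le_nhds (s := Ioi 0))
    simp only [zero_smul, zero_mul, add_zero] at h2
    exact (h2.eventually_const_lt (sub_pos.2 hlt)).mono fun ε hε => sub_pos.1 hε
  have hmem : ∀ᶠ ε in 𝓝[>] (0 : ℝ), A ε ∈ ⋃₀ {C | IsMaximalChamber P C} := by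
    filter_upwards [harr, hlev, habove, hn.eventually_const_lt zero_lt_one,
      self_mem_nhdsWithin] with ε h1 h2 h3 h4 h5
    have h5 : 0 < ε := h5
    have hinv : 0 < (n ε)⁻¹ := inv_pos.2 h4
    have hin : ∀ v, ⟪(n ε)⁻¹ • (a + ε • g), v⟫ = (n ε)⁻¹ * ⟪a + ε • g, v⟫ := fun v => by
      rw [inner_smul_left, conj_trivial]
    obtain ⟨C, hC, hmem⟩ := exists_maximalChamber (a := (A ε).1) (t := (A ε).2) hfin hsymm
      (by
        simp only [A, norm_smul, norm_inv, Real.norm_eq_abs, abs_of_pos h4]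
        exact inv_mul_cancel₀ h4.ne')
      (by
        rintro ⟨v, hv, w, hw, hvw, h0⟩
        simp only [A, hin] at h0
        exact h1 v hv w hw hvw ((mul_eq_zero.1 h0).resolve_left hinv.ne'))
      (by simp only [A]; positivity)
      (fun v hv h => h2 v hv (by
        simp only [A, hin, mul_div_assoc] at h
        exact mul_left_cancel₀ hinv.ne' h))
      ⟨v₀, hv₀, by
        simp only [A, hin, mul_div_assoc]
        exact mul_lt_mul_of_pos_left h3 hinv⟩
    exact ⟨C, hC, hmem⟩
  have hcl := mem_closure_of_tendsto hlim hmem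
  rw [(finite_maximalChambers hfin).closure_sUnion] at hcl
  obtain ⟨C, hC, hmem⟩ := mem_iUnion₂.1 hcl
  exact ⟨C, hC, hmem⟩

end Chambers

/-! ### The volume function -/

section SlabVolume

variable {d : ℕ} {N : Seminorm ℝ (EuclideanSpace ℝ (Fin d))}

lemma isClosed_abs_inner_le (y : EuclideanSpace ℝ (Fin d) × ℝ) :
    IsClosed {x : EuclideanSpace ℝ (Fin d) | |⟪y.1, x⟫| ≤ y.2 / 2} :=
  isClosed_le (by fun_prop) continuous_const

lemma isCompact_slab (hN : IsPolyhedralNorm N) (y : EuclideanSpace ℝ (Fin d) × ℝ) :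
    IsCompact (slab N y.1 y.2) :=
  hN.isCompact_normBall.inter_right (isClosed_abs_inner_le y)

lemma convex_slab (hN : IsPolyhedralNorm N) (y : EuclideanSpace ℝ (Fin d) × ℝ) :
    Convex ℝ (slab N y.1 y.2) := by
  obtain ⟨ι, _, h, b, hP⟩ := hN.exists_normBall_eq_poly
  rw [← slabOf_normBall, hP, slabOf_poly]
  exact convex_poly

/-- The volume of slabs depends continuously on the parameter, by dominated convergence: the
boundary hyperplanes are null sets. -/
lemma continuousAt_slabVolume (hN : IsPolyhedralNorm N) {y : EuclideanSpace ℝ (Fin d) × ℝ}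
    (hy : y.1 ≠ 0) : ContinuousAt (slabVolume N) y := by
  have hP := hN.isCompact_normBall
  have hmeas : ∀ z : EuclideanSpace ℝ (Fin d) × ℝ, MeasurableSet (slab N z.1 z.2) := fun z =>
    (isCompact_slab hN z).isClosed.measurableSet
  have heq : slabVolume N = fun z => ∫ x, (slab N z.1 z.2).indicator 1 x := by
    ext z
    rw [integral_indicator_one (hmeas z), slabVolume]
  rw [heq]
  refine continuousAt_of_dominated (bound := (normBall N).indicator 1) ?_ ?_ ?_ ?_
  · exact Eventually.of_forall fun z =>
      (measurable_one.indicator (hmeas z)).aestronglyMeasurable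
  · refine Eventually.of_forall fun z => Eventually.of_forall fun x => ?_
    have h0 : (0 : ℝ) ≤ (slab N z.1 z.2).indicator 1 x :=
      indicator_nonneg (fun _ _ => zero_le_one) _
    rw [Real.norm_of_nonneg h0]
    exact indicator_le_indicator_of_subset (fun x hx => hx.1) (fun _ => zero_le_one) x
  · exact (integrable_indicator_iff hP.isClosed.measurableSet).2
      (integrableOn_const hP.measure_lt_top.ne)
  · have h1 : ∀ s : ℝ, ∀ᵐ x : EuclideanSpace ℝ (Fin d), ⟪y.1, x⟫ ≠ s := fun s =>
      measure_eq_zero_iff_ae_notMem.1 (volume_hyperplane hy s)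
    filter_upwards [h1 (y.2 / 2), h1 (-(y.2 / 2))] with x hx1 hx2
    have hc1 : ContinuousAt (fun z : EuclideanSpace ℝ (Fin d) × ℝ => |⟪z.1, x⟫|) y := by fun_prop
    have hc2 : ContinuousAt (fun z : EuclideanSpace ℝ (Fin d) × ℝ => z.2 / 2) y := by fun_prop
    have hev : ∀ᶠ z in 𝓝 y, (x ∈ slab N z.1 z.2 ↔ x ∈ slab N y.1 y.2) := by
      have hne : |⟪y.1, x⟫| ≠ y.2 / 2 := fun h => by
        rcases abs_choice ⟪y.1, x⟫ with h' | h' <;> rw [h'] at h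
        · exact hx1 h
        · exact hx2 (by linarith)
      rcases hne.lt_or_gt with hlt | hlt
      · filter_upwards [hc1.eventually_lt hc2 hlt] with z hz
        exact and_congr_right fun _ => ⟨fun _ => hlt.le, fun _ => hz.le⟩
      · filter_upwards [hc2.eventually_lt hc1 hlt] with z hz
        exact and_congr_right fun _ => ⟨fun h => absurd h hz.not_ge, fun h => absurd h hlt.not_ge⟩
    refine (continuousAt_const (y := (slab N y.1 y.2).indicator 1 x)).congr ?_
    filter_upwards [hev] with z hz
    by_cases hxy : x ∈ slab N y.1 y.2
    · rw [indicator_of_mem hxy, indicator_of_mem (hz.2 hxy)]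
    · rw [indicator_of_notMem hxy, indicator_of_notMem (mt hz.1 hxy)]

/-- By symmetry, the slab arises from the ball by cutting off two caps of the same volume. -/
lemma slabVolume_eq_sub (hN : IsPolyhedralNorm N) {y : EuclideanSpace ℝ (Fin d) × ℝ}
    (hy : 0 ≤ y.2) : slabVolume N y =
      volume.real (normBall N) - 2 * volume.real (normBall N ∩ {x | y.2 / 2 < ⟪y.1, x⟫}) := by
  have hP := hN.isCompact_normBall
  set U := normBall N ∩ {x | y.2 / 2 < ⟪y.1, x⟫} with hU
  set U' := normBall N ∩ {x | ⟪y.1, x⟫ < -(y.2 / 2)} with hU'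
  have hfin : volume (normBall N) ≠ ⊤ := hP.measure_lt_top.ne
  have hsplit := measureReal_inter_add_sdiff (μ := volume) (s := normBall N)
    (isClosed_abs_inner_le y).measurableSet hfin
  have hdiff : normBall N \ {x | |⟪y.1, x⟫| ≤ y.2 / 2} = U ∪ U' := by
    ext x
    simp only [hU, hU', Set.mem_sdiff, mem_union, mem_inter_iff, mem_ofPred_eq, not_le, lt_abs,
      ← and_or_left]
    refine and_congr_right fun _ => or_congr_right ?_
    constructor <;> intro <;> linarith
  have hdisj : Disjoint U U' := by
    rw [disjoint_left]
    rintro x ⟨-, hx⟩ ⟨-, hx'⟩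
    have hx : y.2 / 2 < ⟪y.1, x⟫ := hx
    have hx' : ⟪y.1, x⟫ < -(y.2 / 2) := hx'
    linarith
  have hmeas : MeasurableSet U' := by
    have h1 : IsOpen {x : EuclideanSpace ℝ (Fin d) | ⟪y.1, x⟫ < -(y.2 / 2)} :=
      isOpen_lt (by fun_prop) continuous_const
    exact hP.isClosed.measurableSet.inter h1.measurableSet
  have hneg : U' = Neg.neg ⁻¹' U := by
    ext x
    simp only [hU, hU', mem_inter_iff, mem_preimage, mem_ofPred_eq, inner_neg_right]
    refine and_congr ⟨neg_mem_normBall, fun h => by simpa using neg_mem_normBall h⟩ ?_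
    constructor <;> intro <;> linarith
  have hvol : volume.real U' = volume.real U := by
    rw [hneg, measureReal_def, measureReal_def, Measure.measure_preimage_neg]
  rw [hdiff, measureReal_union hdisj hmeas (measure_ne_top_of_subset inter_subset_left hfin)
    (measure_ne_top_of_subset inter_subset_left hfin), hvol] at hsplit
  have : slabVolume N y = volume.real (normBall N ∩ {x | |⟪y.1, x⟫| ≤ y.2 / 2}) := rfl
  rw [this]
  linarith

lemma hasRationalFormula_slabVolume (hN : IsPolyhedralNorm N)
    {C : Set (EuclideanSpace ℝ (Fin d) × ℝ)} (hC : IsMaximalChamber (normBall N) C) :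
    HasRationalFormula C (slabVolume N) := by
  obtain ⟨ι, _, h, b, hP⟩ := hN.exists_normBall_eq_poly
  have hfin : (vertices (normBall N)).Finite := by rw [hP]; exact finite_extremePoints_poly
  have hhull : convexHull ℝ (vertices (normBall N)) = normBall N :=
    convexHull_extremePoints_eq hN.isCompact_normBall (by rw [hP]; exact convex_poly) hfin
  have hsymm : ∀ v ∈ vertices (normBall N), -v ∈ vertices (normBall N) :=
    fun v hv => neg_mem_vertices_normBall hv
  obtain ⟨m, v, D, hinj, hmem, hvol⟩ := exists_volume_inter_halfSpace_eq hfin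
  have htrunc : ∀ w ∈ vertices (normBall N),
      HasRationalFormula C fun y => truncPow d (-(y.2 / 2) + 1 * ⟪y.1, w⟫) := by
    intro w hw
    have hlin : HasRationalFormula C fun y => (-(y.2 / 2) + 1 * ⟪y.1, w⟫) ^ d :=
      ((HasRationalFormula.snd.div (.const 2) fun _ _ => two_ne_zero).neg.add
        ((HasRationalFormula.const 1).mul (.inner w))).pow d
    -- On a chamber the sign of `⟨a, w⟩ - t / 2` is constant.
    by_cases hex : ∃ z ∈ C, z.2 / 2 < ⟪z.1, w⟫
    · obtain ⟨z, hz, hlt⟩ := hex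
      refine hlin.congr fun y hy => if_pos ?_
      linarith [((hC.sameSides hsymm hz hy) w hw).1.1 hlt]
    · refine (HasRationalFormula.const 0).congr fun y hy => if_neg fun hlt => hex ⟨y, hy, ?_⟩
      linarith
  have hcut : ∀ k, HasRationalFormula C
      fun y => cutVolume (fun i => ⟪y.1, v k i⟫) 1 (-(y.2 / 2)) := by
    intro k
    unfold cutVolume
    refine (HasRationalFormula.const _).mul (.sum _ fun i => (htrunc _ (hmem k i)).div ?_ ?_)
    · refine .prod _ fun l => ?_
      by_cases hl : l = i
      · simpa only [if_pos hl] using .const 1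
      · simpa only [if_neg hl] using (HasRationalFormula.inner (v k i)).sub (.inner (v k l))
    · exact fun y hy => nodeProd_ne_zero (fun i j hij =>
        hinj k (hC.injOn_inner hy (hmem k i) (hmem k j) hij)) i
  refine ((HasRationalFormula.const (volume.real (normBall N))).sub
    ((HasRationalFormula.const 2).mul
      (.sum Finset.univ fun k => (HasRationalFormula.const (D k)).mul (hcut k)))).congr
    fun y hy => ?_
  rw [slabVolume_eq_sub hN (hC.isGenericFor hsymm hy).pos.le, ← hvol y.1 _ (hC.injOn_inner hy),
    hhull]

variable {C : Set (EuclideanSpace ℝ (Fin d) × ℝ)}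

lemma IsMaximalChamber.norm_eq_one_of_mem_closure {P : Set (EuclideanSpace ℝ (Fin d))}
    (hC : IsMaximalChamber P C) {y : EuclideanSpace ℝ (Fin d) × ℝ} (hy : y ∈ closure C) :
    ‖y.1‖ = 1 := by
  have hcl : IsClosed {y : EuclideanSpace ℝ (Fin d) × ℝ | ‖y.1‖ = 1} :=
    isClosed_eq (by fun_prop) continuous_const
  exact closure_minimal (fun z hz => hC.norm_eq_one hz) hcl hy

lemma continuousAt_slabVolume_of_mem_closure (hN : IsPolyhedralNorm N)
    (hC : IsMaximalChamber (normBall N) C) {y : EuclideanSpace ℝ (Fin d) × ℝ}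
    (hy : y ∈ closure C) : ContinuousAt (slabVolume N) y := by
  refine continuousAt_slabVolume hN fun h => ?_
  have := hC.norm_eq_one_of_mem_closure hy
  simp [h] at this

lemma tendsto_of_isRationalFormula (hN : IsPolyhedralNorm N)
    (hC : IsMaximalChamber (normBall N) C) {p q : MvPolynomial (Option (Fin d)) ℝ}
    (hpq : IsRationalFormula C (slabVolume N) p q) {y : EuclideanSpace ℝ (Fin d) × ℝ}
    (hy : y ∈ closure C) :
    Tendsto (fun z => polyVal p z / polyVal q z) (𝓝[C] y) (𝓝 (slabVolume N y)) := by
  refine ((continuousAt_slabVolume_of_mem_closure hN hC hy).tendsto.mono_left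
    nhdsWithin_le_nhds).congr' ?_
  filter_upwards [self_mem_nhdsWithin] with z hz using (hpq z hz).2

lemma continuous_polyVal (p : MvPolynomial (Option (Fin d)) ℝ) :
    Continuous (polyVal p) := by
  refine p.continuous_eval.comp (continuous_pi fun o => ?_)
  cases o with
  | none => exact continuous_snd
  | some i =>
    change Continuous fun y : EuclideanSpace ℝ (Fin d) × ℝ => y.1 i
    fun_prop

end SlabVolume

/-! ### Slabs with parameters in a chamber -/

section SlabsInChamber

variable {d : ℕ} {N : Seminorm ℝ (EuclideanSpace ℝ (Fin d))}
  {C : Set (EuclideanSpace ℝ (Fin d) × ℝ)}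

lemma hasRationalFormula_edgePoint {v w : EuclideanSpace ℝ (Fin d)}
    (h0 : ∀ y ∈ C, ⟪y.1, w - v⟫ ≠ 0) {f : EuclideanSpace ℝ (Fin d) × ℝ → ℝ}
    (hf : HasRationalFormula C f) (c : Fin d) :
    HasRationalFormula C fun y => edgePoint v w y.1 (f y) c := by
  have hden := HasRationalFormula.inner (C := C) (w - v)
  have h1 := ((hf.div (.const 2) fun _ _ => two_ne_zero).div hden h0).mul (.const ((w - v) c))
  have h2 := ((HasRationalFormula.const 1).div hden h0).mul
    (((HasRationalFormula.inner w).mul (.const (v c))).sub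
      ((HasRationalFormula.inner v).mul (.const (w c))))
  exact (h1.add h2).congr fun y _ => by simp [edgePoint]

/-- The vertices of the slabs with parameters in a chamber are labelled by a common set, namely by
the labels for any one parameter. -/
lemma exists_vertex_parametrization (hN : IsPolyhedralNorm N)
    (hC : IsMaximalChamber (normBall N) C) :
    ∃ (k : ℕ) (x : Fin k → EuclideanSpace ℝ (Fin d) × ℝ → EuclideanSpace ℝ (Fin d)),
      (∀ i, IsVertexFormula (normBall N) (x i)) ∧
      (∀ i c, ∃ p q, IsRationalFormula C (fun y => x i y c) p q) ∧
      (∀ y ∈ C, Function.Injective (fun i => x i y) ∧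
        range (fun i => x i y) = vertices (slab N y.1 y.2)) ∧
      ∀ y ∈ C, ∀ z ∈ C, ∀ σ : Set (Fin k),
        IsExposed ℝ (slab N y.1 y.2) (convexHull ℝ ((fun i => x i y) '' σ)) ↔
        IsExposed ℝ (slab N z.1 z.2) (convexHull ℝ ((fun i => x i z) '' σ)) := by
  rcases C.eq_empty_or_nonempty with rfl | ⟨y₀, hy₀⟩
  · exact ⟨0, fun i => i.elim0, fun i => i.elim0, fun i => i.elim0, by simp, by simp⟩
  have hsymm : ∀ v ∈ vertices (normBall N), -v ∈ vertices (normBall N) :=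
    fun v hv => neg_mem_vertices_normBall hv
  have hgen := fun y (hy : y ∈ C) => hC.isGenericFor hsymm hy
  have hside := fun y (hy : y ∈ C) => hC.sameSides hsymm hy₀ hy
  have hcomp := hN.isCompact_normBall
  simp only [← slabOf_normBall]
  obtain ⟨ι, _, h, b, hP⟩ := hN.exists_normBall_eq_poly
  rw [hP] at hgen hside hcomp ⊢
  have := finite_vertexLabel (P := poly h b) finite_extremePoints_poly y₀
  obtain ⟨k, ⟨e⟩⟩ := Finite.exists_equiv_fin (VertexLabel (poly h b) y₀)
  have hrat : ∀ (l : VertexLabel (poly h b) y₀) c,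
      HasRationalFormula C fun y => labelPoint l y c := by
    intro l c
    rcases l with v | f | f
    · exact HasRationalFormula.const (v.1 c)
    · refine hasRationalFormula_edgePoint (fun y hy => ?_) .snd c
      have := (f.2.of_sameSides (hgen y hy) (hside y hy)).2
      rw [inner_sub_right]
      exact (sub_pos.2 (this.1.trans this.2)).ne'
    · refine hasRationalFormula_edgePoint (fun y hy => ?_) (HasRationalFormula.snd.neg) c
      have := (f.2.of_sameSides_neg (hgen y hy) (hside y hy)).2
      rw [inner_sub_right]
      exact (sub_pos.2 (this.1.trans this.2)).ne'
  refine ⟨k, fun i => labelPoint (e.symm i), fun i => isVertexFormula_labelPoint _,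
    fun i c => hrat _ c, fun y hy => ⟨?_, ?_⟩, fun y hy z hz σ => ?_⟩
  · exact (injective_labelPoint (hgen y hy) (hside y hy)).comp e.symm.injective
  · rw [← range_labelPoint hcomp (hgen y₀ hy₀) (hgen y hy) (hside y hy)]
    exact e.symm.surjective.range_comp (fun l => labelPoint l y)
  · have := isExposed_labelPoint_iff hcomp (hgen y₀ hy₀) (hgen y hy) (hgen z hz) (hside y hy)
      (hside z hz) (e.symm '' σ)
    simpa only [image_image] using this

end SlabsInChamber

end SlabChambers

theorem mainTheorem6 (d : ℕ) (N : Seminorm ℝ (EuclideanSpace ℝ (Fin d)))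
    (hN : SlabChambers.IsPolyhedralNorm N) :
    (∀ C : Set (EuclideanSpace ℝ (Fin d) × ℝ),
      SlabChambers.IsMaximalChamber (SlabChambers.normBall N) C →
      -- same combinatorial type
      (∀ y ∈ C, ∀ z ∈ C, SlabChambers.SameCombinatorialType
        (SlabChambers.slab N y.1 y.2) (SlabChambers.slab N z.1 z.2)) ∧
      -- same rational parametrization of the vertices, compatible with the faces
      (∃ (k : ℕ) (x : Fin k → EuclideanSpace ℝ (Fin d) × ℝ → EuclideanSpace ℝ (Fin d)),
        (∀ i, SlabChambers.IsVertexFormula (SlabChambers.normBall N) (x i)) ∧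
        (∀ i c, ∃ p q, SlabChambers.IsRationalFormula C (fun y => x i y c) p q) ∧
        (∀ y ∈ C, Function.Injective (fun i => x i y) ∧
          Set.range (fun i => x i y) = SlabChambers.vertices (SlabChambers.slab N y.1 y.2)) ∧
        (∀ y ∈ C, ∀ z ∈ C, ∀ σ : Set (Fin k),
          IsExposed ℝ (SlabChambers.slab N y.1 y.2) (convexHull ℝ ((fun i => x i y) '' σ)) ↔
          IsExposed ℝ (SlabChambers.slab N z.1 z.2) (convexHull ℝ ((fun i => x i z) '' σ)))) ∧
      -- the volume is a rational function on the chamber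
      (∃ p q, SlabChambers.IsRationalFormula C (SlabChambers.slabVolume N) p q) ∧
      -- every such formula extends by continuity to the closure and gives the volume there
      ContinuousOn (SlabChambers.slabVolume N) (closure C) ∧
      (∀ p q, SlabChambers.IsRationalFormula C (SlabChambers.slabVolume N) p q →
        ∀ y ∈ closure C,
          Tendsto (fun z => SlabChambers.polyVal p z / SlabChambers.polyVal q z) (𝓝[C] y)
            (𝓝 (SlabChambers.slabVolume N y)) ∧
          (SlabChambers.polyVal q y ≠ 0 → SlabChambers.slabVolume N y =
            SlabChambers.polyVal p y / SlabChambers.polyVal q y))) ∧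
    -- the formulas of two chambers agree along their common boundary
    (∀ C C' : Set (EuclideanSpace ℝ (Fin d) × ℝ),
      SlabChambers.IsMaximalChamber (SlabChambers.normBall N) C →
      SlabChambers.IsMaximalChamber (SlabChambers.normBall N) C' →
      ∀ p q p' q', SlabChambers.IsRationalFormula C (SlabChambers.slabVolume N) p q →
        SlabChambers.IsRationalFormula C' (SlabChambers.slabVolume N) p' q' →
        ∀ y ∈ closure C ∩ closure C', ∃ l : ℝ,
          Tendsto (fun z => SlabChambers.polyVal p z / SlabChambers.polyVal q z) (𝓝[C] y) (𝓝 l) ∧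
          Tendsto (fun z => SlabChambers.polyVal p' z / SlabChambers.polyVal q' z)
            (𝓝[C'] y) (𝓝 l)) ∧
    -- the finitely many chambers account for all slabs
    {C | SlabChambers.IsMaximalChamber (SlabChambers.normBall N) C}.Finite ∧
    (∀ (a : EuclideanSpace ℝ (Fin d)) (t : ℝ), ‖a‖ = 1 → 0 ≤ t →
      (∃ C, SlabChambers.IsMaximalChamber (SlabChambers.normBall N) C ∧ (a, t) ∈ closure C) ∨
        SlabChambers.slab N a t = SlabChambers.normBall N) := by
  have hsymm : ∀ v ∈ SlabChambers.vertices (SlabChambers.normBall N),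
      -v ∈ SlabChambers.vertices (SlabChambers.normBall N) :=
    fun v hv => SlabChambers.neg_mem_vertices_normBall hv
  obtain ⟨hfin, hhull⟩ : (SlabChambers.vertices (SlabChambers.normBall N)).Finite ∧
      convexHull ℝ (SlabChambers.vertices (SlabChambers.normBall N)) =
        SlabChambers.normBall N := by
    have hcomp := hN.isCompact_normBall
    obtain ⟨ι, _, h, b, hP⟩ := hN.exists_normBall_eq_poly
    rw [hP] at hcomp ⊢
    exact ⟨SlabChambers.finite_extremePoints_poly, SlabChambers.convexHull_extremePoints_eq hcomp
      SlabChambers.convex_poly SlabChambers.finite_extremePoints_poly⟩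
  refine ⟨fun C hC => ?_, fun C C' hC hC' p q p' q' hpq hpq' y hy => ⟨_,
    SlabChambers.tendsto_of_isRationalFormula hN hC hpq hy.1,
    SlabChambers.tendsto_of_isRationalFormula hN hC' hpq' hy.2⟩,
    SlabChambers.finite_maximalChambers hfin, fun a t ha ht => ?_⟩
  · obtain ⟨k, x, hformula, hrat, hvert, hface⟩ := SlabChambers.exists_vertex_parametrization hN hC
    refine ⟨fun y hy z hz => ?_, ⟨k, x, hformula, hrat, hvert, hface⟩,
      SlabChambers.hasRationalFormula_slabVolume hN hC, fun y hy =>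
        (SlabChambers.continuousAt_slabVolume_of_mem_closure hN hC hy).continuousWithinAt,
      fun p q hpq y hy => ?_⟩
    · exact SlabChambers.nonempty_orderIso_exposed (SlabChambers.isCompact_slab hN y)
        (SlabChambers.convex_slab hN y) (SlabChambers.isCompact_slab hN z)
        (SlabChambers.convex_slab hN z) (hvert y hy).1 (hvert z hz).1 (hvert y hy).2 (hvert z hz).2
        (hface y hy z hz)
    · have hlim := SlabChambers.tendsto_of_isRationalFormula hN hC hpq hy
      refine ⟨hlim, fun hq => ?_⟩
      have := mem_closure_iff_nhdsWithin_neBot.1 hy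
      exact tendsto_nhds_unique hlim
        (((SlabChambers.continuous_polyVal p).continuousAt.div
          (SlabChambers.continuous_polyVal q).continuousAt hq).tendsto.mono_left
            nhdsWithin_le_nhds)
  · by_cases hex : ∃ v ∈ SlabChambers.vertices (SlabChambers.normBall N), t / 2 < ⟪a, v⟫
    · exact .inl (SlabChambers.exists_mem_closure_maximalChamber hfin hsymm ha ht hex)
    · -- All vertices lie in the slab, hence so does their convex hull.
      right
      push Not at hex
      have hhalf : SlabChambers.normBall N ⊆ {x | innerSL ℝ a x ≤ t / 2} := by
        rw [← hhull]
        exact convexHull_min hex (convex_halfSpace_le (innerSL ℝ a).isLinear _)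
      refine Subset.antisymm (fun x hx => hx.1) fun x hx => ⟨hx, abs_le.2 ⟨?_, hhalf hx⟩⟩
      have h1 : ⟪a, -x⟫ ≤ t / 2 := hhalf (SlabChambers.neg_mem_normBall hx)
      rw [inner_neg_right] at h1
      linarith
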